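/- Let $n,m\ge 1$, $d\ge 0$, $\lambda\ge 0$, $\mu>0$, $\tilde L\ge 0$. For $1\le i\le n$, $1\le j\le m$ let $f'_{ij}:\mathbb{R}^d\to\mathbb{R}$ be convex, differentiable and $\tilde L$-smooth (its gradient is $\tilde L$-Lipschitz), and let each $f_i=\frac1m\sum_{j=1}^m f'_{ij}$ be $\mu$-strongly convex. For $x=(x_1,\dots,x_n)\in(\mathbb{R}^d)^n$ put $\bar x=\frac1n\sum_i x_i$ and $$F(x)=\frac1n\sum_{i=1}^n f_i(x_i)+\frac{\lambda}{2n}\sum_{i=1}^n\|x_i-\bar x\|^2 .$$ *The algorithm.* L2SGD+ with probability $p\in(0,1)$ and stepsize $\alpha$ starts from $x_1^0=\dots=x_n^0\in\mathbb{R}^d$, $J^0_{ij}=0$, $\Psi^0_i=0$. In iteration $k\ge 0$ an independent coin $\xi^k$ is tossed, $\xi^k=1$ with probability $p$ and $\xi^k=0$ with probability $1-p$, and $x_i^{k+1}=x_i^k-\alpha g_i^k$, where: - if $\xi^k=0$, each device $i$ independently samples $j_i\in\{1,\dots,m\}$ uniformly, $g_i^k=\frac{1}{n(1-p)}\big(\nabla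 f'_{i j_i}(x_i^k)-J^k_{i j_i}\big)+\frac{1}{nm}\sum_{l} J^k_{il}+\frac1n\Psi_i^k$, and $J^{k+1}_{ij_i}=\nabla f'_{ij_i}(x_i^k)$, $J^{k+1}_{il}=J^k_{il}$ for $l\ne j_i$, $\Psi_i^{k+1}=\Psi_i^k$; - if $\xi^k=1$, $g_i^k=\frac{\lambda}{np}(x_i^k-\bar x^k)-\frac{p^{-1}-1}{n}\Psi_i^k+\frac{1}{nm}\sum_l J^k_{il}$, and $\Psi_i^{k+1}=\lambda(x_i^k-\bar x^k)$, $J_{il}^{k+1}=J_{il}^k$ for all $l$. The stepsize is $\alpha=\alpha(p)=n\min\big\{\frac{1-p}{4\tilde L+\mu m},\frac{p}{4\lambda+\mu}\big\}$. A communication takes place whenever two consecutive coin tosses differ (devices to master when $0$ is followed by $1$, master to devices when $1$ is followed by $0$); a communication round is such a pair, counted when it is completed, so the number of rounds in $k$ iterations is $\#\{l<k:\xi^l=1,\ \xi^{l+1}=0\}$. *Complexities.* For $\varepsilon\in(0,1)$ and $p\in(0,1)$ let $$T_\varepsilon(p)=\max\Big\{\frac{4\tilde L+\mu m}{(1-p)\mu},\frac{4\lambda+\mu}{p\mu}\Big\}\log\frac1\varepsilon$$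 be the (guaranteed) iteration complexity, and let the communication complexity $C_\varepsilon(p)$ be the expected number of communication rounds per iteration (that is, in one iteration) times $T_\varepsilon(p)$. *Claim.* 1. $F$ has a unique minimizer $x^\star$. For all $p,\varepsilon\in(0,1)$, every starting point and every integer $k\ge T_\varepsilon(p)$, the iterates satisfy $\mathbb{E}[\Phi^k]\le\varepsilon\,\Phi^0$, where $$\Phi^k=\sum_{i}\|x_i^k-x_i^\star\|^2+\alpha\Big(\frac{1}{2n(1-p)\tilde L}\sum_{i,j}\|J_{ij}^k-\nabla f'_{ij}(x_i^\star)\|^2+\frac{1}{2np\lambda}\sum_i\|\Psi_i^k-\lambda(x_i^\star-\bar x^\star)\|^2\Big)$$ (a term whose factor $\tilde L$ or $\lambda$ in the denominator is $0$ is omitted). 2. For all $p\in(0,1)$ and $k\ge 0$, the expected number of communication rounds in $k$ iterations is $p(1-p)k$; hence $C_\varepsilon(p)=p(1-p)T_\varepsilon(p)$. 3. Put $p^\star=\frac{4\lambda+\mu}{4\lambda+4\tilde L+(m+1)\mu}$. Then $p^\star\in(0,1)$, and for every $\varepsilon\in(0,1)$, $p^\star$ is the unique minimizer over $p\in(0,1)$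 of the iteration complexity $T_\varepsilon(p)$ and also the unique minimizer over $p\in(0,1)$ of the communication complexity $C_\varepsilon(p)$. The minimal values are $$T_\varepsilon(p^\star)=\Big(4\frac{\lambda}{\mu}+4\frac{\tilde L}{\mu}+m+1\Big)\log\frac1\varepsilon,\qquad C_\varepsilon(p^\star)=\frac{4\lambda+\mu}{4\tilde L+4\lambda+(m+1)\mu}\Big(4\frac{\tilde L}{\mu}+m\Big)\log\frac1\varepsilon .$$ -/

import Mathlib

open MeasureTheory Set
open scoped NNReal ENNReal

noncomputable section

namespace L2SGDPlus

/-- The space `ℝ^d` with its Euclidean norm. -/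
abbrev Vec (d : ℕ) : Type := EuclideanSpace ℝ (Fin d)

variable {n m d : ℕ}

/-- The average `x̄ = (1/n) ∑ᵢ xᵢ` of the local models. -/
def average (x : Fin n → Vec d) : Vec d := (n : ℝ)⁻¹ • ∑ i, x i

/-- The loss `fᵢ = (1/m) ∑ⱼ f'ᵢⱼ` of device `i`, where `φ i j` stands for `f'ᵢⱼ`. -/
def localLoss (φ : Fin n → Fin m → Vec d → ℝ) (i : Fin n) (z : Vec d) : ℝ :=
  (m : ℝ)⁻¹ * ∑ j, φ i j z

/-- The objective `F(x) = (1/n) ∑ᵢ fᵢ(xᵢ) + λ · (1/(2n)) ∑ᵢ ‖xᵢ - x̄‖²`. -/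
def objective (lam : ℝ) (φ : Fin n → Fin m → Vec d → ℝ) (x : Fin n → Vec d) : ℝ :=
  (n : ℝ)⁻¹ * ∑ i, localLoss φ i (x i)
    + lam * ((2 * (n : ℝ))⁻¹ * ∑ i, ‖x i - average x‖ ^ 2)

/-- The memory of the algorithm: the local models `xᵢ`, the gradient tables `Jᵢ`
(`J i j` is column `j` of the table of device `i`), and the control variates `Ψᵢ`. -/
structure State (n m d : ℕ) where
  x : Fin n → Vec d
  J : Fin n → Fin m → Vec d
  Psi : Fin n → Vec d

/-- The randomness of one iteration: the coin `ξ` (`true` means `ξ = 1`) and, for every device,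
the index that it samples (used only when `ξ = 0`). -/
abbrev Draw (n m : ℕ) : Type := Bool × (Fin n → Fin m)

/-- The search direction `gᵢ`. -/
def direction (lam p : ℝ) (φ : Fin n → Fin m → Vec d → ℝ) (s : State n m d) (w : Draw n m)
    (i : Fin n) : Vec d :=
  if w.1 = false then
    (1 / (n * (1 - p))) • (gradient (φ i (w.2 i)) (s.x i) - s.J i (w.2 i))
      + (1 / ((n : ℝ) * m)) • (∑ j, s.J i j) + (1 / (n : ℝ)) • s.Psi i
  else
    (lam / (n * p)) • (s.x i - average s.x) - ((p⁻¹ - 1) / n) • s.Psi i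
      + (1 / ((n : ℝ) * m)) • (∑ j, s.J i j)

/-- One iteration of L2SGD+ with parameter `λ`, probability `p` and stepsize `α`. -/
def step (lam p α : ℝ) (φ : Fin n → Fin m → Vec d → ℝ) (s : State n m d) (w : Draw n m) :
    State n m d where
  x := fun i => s.x i - α • direction lam p φ s w i
  J := fun i j =>
    if w.1 = false ∧ j = w.2 i then gradient (φ i j) (s.x i) else s.J i j
  Psi := fun i => if w.1 = false then s.Psi i else lam • (s.x i - average s.x)

/-- The state after `k` iterations, started at `x₁ = ⋯ = xₙ = x0`, `J = 0`, `Ψ = 0`,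
when iteration `l` uses the randomness `ω l`. -/
def iterate (lam p α : ℝ) (φ : Fin n → Fin m → Vec d → ℝ) (x0 : Vec d) (ω : ℕ → Draw n m) :
    ℕ → State n m d
  | 0 => ⟨fun _ => x0, fun _ _ => 0, fun _ => 0⟩
  | k + 1 => step lam p α φ (iterate lam p α φ x0 ω k) (ω k)

/-- The law of a coin that lands `1` (`true`) with probability `p` and `0` (`false`) with
probability `1 - p`. -/
def coinLaw (p : ℝ) : Measure Bool :=
  ENNReal.ofReal p • Measure.dirac true + ENNReal.ofReal (1 - p) • Measure.dirac false

/-- The law of the randomness of one iteration: the coin and the indices of the devices are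
independent, each index being uniform. -/
def drawLaw (n m : ℕ) [NeZero m] (p : ℝ) : Measure (Draw n m) :=
  (coinLaw p).prod (Measure.pi fun _ : Fin n => (PMF.uniformOfFintype (Fin m)).toMeasure)

/-- The law of the randomness of the whole run: independent iterations (for `0 < p < 1`, where
`drawLaw n m p` is a probability measure). -/
def runLaw (n m : ℕ) [NeZero m] (p : ℝ) : Measure (ℕ → Draw n m) :=
  Measure.infinitePi fun _ : ℕ => drawLaw n m p

/-- The stepsize `α = n min {(1-p)/(4L+μm), p/(4λ+μ)}`. -/
def stepsize (n m : ℕ) (lam μ L p : ℝ) : ℝ :=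
  n * min ((1 - p) / (4 * L + μ * m)) (p / (4 * lam + μ))

/-- The Lyapunov function that measures the distance of a state to the optimum `xs`: the squared
distance of the models plus the weighted squared errors of the control variates.
If `λ = 0` (or `L = 0`), the corresponding term is absent, by `1 / 0 = 0`; the control variates
it measures are then exact (resp. the gradients vanish identically). -/
def lyapunov (lam L p α : ℝ) (φ : Fin n → Fin m → Vec d → ℝ) (xs : Fin n → Vec d)
    (s : State n m d) : ℝ :=
  ∑ i, ‖s.x i - xs i‖ ^ 2
    + α * (1 / (2 * n * (1 - p) * L) * ∑ i, ∑ j, ‖s.J i j - gradient (φ i j) (xs i)‖ ^ 2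
      + 1 / (2 * n * p * lam) * ∑ i, ‖s.Psi i - lam • (xs i - average xs)‖ ^ 2)

/-- From iteration number `N` on, L2SGD+ has reduced the expected Lyapunov function to at most
`ε` times its initial value. -/
def ReachesAccuracyAfter [NeZero m] (lam L p α : ℝ) (φ : Fin n → Fin m → Vec d → ℝ)
    (xs : Fin n → Vec d) (x0 : Vec d) (ε N : ℝ) : Prop :=
  ∀ k : ℕ, N ≤ k →
    Integrable (fun ω => lyapunov lam L p α φ xs (iterate lam p α φ x0 ω k)) (runLaw n m p) ∧
    ∫ ω, lyapunov lam L p α φ xs (iterate lam p α φ x0 ω k) ∂(runLaw n m p)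
      ≤ ε * lyapunov lam L p α φ xs ⟨fun _ => x0, fun _ _ => 0, fun _ => 0⟩

/-- The iteration complexity of L2SGD+ with the stepsize above, as a function of `p`. -/
def iterationComplexity (m : ℕ) (lam μ L ε p : ℝ) : ℝ :=
  max ((4 * L + μ * m) / ((1 - p) * μ)) ((4 * lam + μ) / (p * μ)) * Real.log (1 / ε)

/-- The number of communication rounds in `k` iterations. A communication takes place whenever two
consecutive coin tosses differ: devices to master when `0` is followed by `1`, and master to
devices when `1` is followed by `0`. A round is a pair of these, counted on its completion, that is
when `1` is followed by `0`. -/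
def commRounds (ω : ℕ → Draw n m) (k : ℕ) : ℕ :=
  ((Finset.range k).filter fun l => (ω l).1 = true ∧ (ω (l + 1)).1 = false).card

/-- The expected number of communication rounds in `k` iterations. -/
def expectedCommRounds (n m : ℕ) [NeZero m] (p : ℝ) (k : ℕ) : ℝ :=
  ∫ ω, (commRounds ω k : ℝ) ∂(runLaw n m p)

/-- The communication complexity: the expected number of communication rounds per iteration times
the iteration complexity. -/
def communicationComplexity (n m : ℕ) [NeZero m] (lam μ L ε p : ℝ) : ℝ :=
  expectedCommRounds n m p 1 * iterationComplexity m lam μ L ε p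

end L2SGDPlus

end

/-!
The proof is a Lyapunov argument for a variance-reduced stochastic gradient method, followed by an
elementary optimization over the probability `p`.

Each local loss is `μ`-strongly convex, so the objective grows quadratically and has a minimizer
`x⋆`; the first-order condition `∇fᵢ(x⋆ᵢ) + λ (x⋆ᵢ - x̄⋆) = 0` (`localGradient_add_eq_zero`) and the
strong monotonicity of the gradients make it unique.

For a fixed state, the search direction is an unbiased estimator of the gradient of the objective
(`mean_direction`). Because of the first-order condition, it is the deviation of the sampled
gradient from its value at the optimum, minus the centred deviation of the sampled control variate;
so its second moment is at most `2 / n²` times a sum of squared gradient deviations and squared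
control variate errors (`mean_norm_direction_sq_le`). In expectation the control variate errors
move towards the gradient deviations. Strong convexity takes half of
`∑ᵢ ⟪∇fᵢ(xᵢ) - ∇fᵢ(x⋆ᵢ), xᵢ - x⋆ᵢ⟫` for the contraction of the distance, and co-coercivity of the
gradients (`norm_gradient_sub_sq_le_inner`) lets the other half pay for the noise. With the two
bounds on the stepsize (`table_balance`, `control_balance`) the expected Lyapunov function shrinks
by the factor `1 - αμ/n` in each iteration (`integral_lyapunov_step_le`). The draw of iteration `k`
is independent of the state it is applied to (`integral_infinitePi_of_dependsOn`), so the factors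
multiply, and `(1 - αμ/n)ᵏ ≤ exp (-kαμ/n) ≤ ε` once `k` exceeds the iteration complexity, which is
`log (1/ε)` divided by `αμ/n`.

Independence of consecutive coins gives `p (1 - p)` communication rounds per iteration. With
`a = 4L + μm` and `b = 4λ + μ`, the iteration complexity is proportional to
`max (a / (1 - p)) (b / p)` and the communication complexity to `max (p a) ((1 - p) b)`. In each
maximum one term increases and the other decreases in `p`, and they cross at `p = b / (a + b)`.
-/

/-! ### Convex functions and their gradients -/

namespace L2SGDPlus

section ConvexAnalysis

variable {E : Type*} [NormedAddCommGroup E] [InnerProductSpace ℝ E] [CompleteSpace E]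

lemma hasDerivAt_comp_line {f : E → ℝ} {g z v : E} {t : ℝ} (h : HasGradientAt f g (z + t • v)) :
    HasDerivAt (fun t : ℝ => f (z + t • v)) (inner ℝ g v) t := by
  have h1 : HasDerivAt (fun t : ℝ => z + t • v) v t := by
    simpa using ((hasDerivAt_id t).smul_const v).const_add z
  simpa [Function.comp_def] using (hasGradientAt_iff_hasFDerivAt.1 h).comp_hasDerivAt t h1

/-- A strongly convex function lies above its quadratic model: the tangent inequality for the convex
function `f - μ/2 ‖·‖²`, on the line from `w` to `z`. -/
lemma StrongConvexOn.add_inner_add_le {f : E → ℝ} {μ : ℝ} (hf : StrongConvexOn univ μ f)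
    {g w : E} (hg : HasGradientAt f g w) (z : E) :
    f w + inner ℝ g (z - w) + μ / 2 * ‖z - w‖ ^ 2 ≤ f z := by
  have hc := strongConvexOn_iff_convex.1 hf
  have hline : ConvexOn ℝ univ
      (fun t : ℝ => f (w + t • (z - w)) - μ / 2 * ‖w + t • (z - w)‖ ^ 2) := by
    have := hc.comp_affineMap (AffineMap.lineMap w z : ℝ →ᵃ[ℝ] E)
    refine this.congr fun t _ => ?_
    simp [AffineMap.lineMap_apply, add_comm]
  have hd1 : HasDerivAt (fun t : ℝ => f (w + t • (z - w))) (inner ℝ g (z - w)) 0 :=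
    hasDerivAt_comp_line (by simpa using hg)
  have hd2 : HasDerivAt (fun t : ℝ => ‖w + t • (z - w)‖ ^ 2) (2 * inner ℝ w (z - w)) 0 := by
    have h1 : HasDerivAt (fun t : ℝ => w + t • (z - w)) (z - w) 0 := by
      simpa using ((hasDerivAt_id (0 : ℝ)).smul_const (z - w)).const_add w
    simpa using h1.norm_sq
  have key := hline.le_slope_of_hasDerivAt (mem_univ 0) (mem_univ 1) one_pos
    (hd1.sub (hd2.const_mul (μ / 2)))
  simp only [slope_def_field, one_smul, zero_smul, add_zero, sub_zero, div_one,
    add_sub_cancel] at key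
  have hn : ‖z‖ ^ 2 = ‖w‖ ^ 2 + 2 * inner ℝ w (z - w) + ‖z - w‖ ^ 2 := by
    rw [← norm_add_sq_real, add_sub_cancel]
  rw [hn] at key
  linarith

lemma StrongConvexOn.mul_norm_sub_sq_le_inner {f : E → ℝ} {μ : ℝ} (hf : StrongConvexOn univ μ f)
    {g g' w z : E} (hg : HasGradientAt f g w) (hg' : HasGradientAt f g' z) :
    μ * ‖z - w‖ ^ 2 ≤ inner ℝ (g' - g) (z - w) := by
  have h1 := StrongConvexOn.add_inner_add_le hf hg z
  have h2 := StrongConvexOn.add_inner_add_le hf hg' w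
  rw [← neg_sub z w, inner_neg_right, norm_neg] at h2
  rw [inner_sub_left]
  linarith

lemma _root_.ConvexOn.add_inner_le {f : E → ℝ} (hf : ConvexOn ℝ univ f)
    {g w : E} (hg : HasGradientAt f g w) (z : E) :
    f w + inner ℝ g (z - w) ≤ f z := by
  simpa using StrongConvexOn.add_inner_add_le (strongConvexOn_zero.2 hf) hg z

/-- The descent lemma: a function with `L`-Lipschitz gradient lies below its quadratic model. -/
lemma le_add_inner_add_of_lipschitz_gradient {f : E → ℝ} {L : ℝ≥0} (hd : Differentiable ℝ f)
    (hL : LipschitzWith L (gradient f)) (z v : E) :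
    f (z + v) ≤ f z + inner ℝ (gradient f z) v + L / 2 * ‖v‖ ^ 2 := by
  set h : ℝ → ℝ := fun t => f (z + t • v) - (t * inner ℝ (gradient f z) v + t ^ 2 * (L / 2 * ‖v‖ ^ 2))
    with h_def
  have hderiv : ∀ t, HasDerivAt h (inner ℝ (gradient f (z + t • v)) v
      - (1 * inner ℝ (gradient f z) v + (2 * t) * (L / 2 * ‖v‖ ^ 2))) t := by
    intro t
    refine (hasDerivAt_comp_line (hd _).hasGradientAt).sub
      (((hasDerivAt_id t).mul_const _).add ?_)
    have := (hasDerivAt_pow 2 t).mul_const ((L : ℝ) / 2 * ‖v‖ ^ 2)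
    simpa using this
  have hanti : AntitoneOn h (Icc 0 1) := by
    refine antitoneOn_of_deriv_nonpos (convex_Icc 0 1)
      (fun t _ => (hderiv t).continuousAt.continuousWithinAt)
      (fun t _ => (hderiv t).differentiableAt.differentiableWithinAt) fun t ht => ?_
    rw [interior_Icc] at ht
    rw [(hderiv t).deriv]
    have h1 : inner ℝ (gradient f (z + t • v) - gradient f z) v ≤ L * (t * ‖v‖) * ‖v‖ := by
      refine (real_inner_le_norm _ _).trans (mul_le_mul_of_nonneg_right ?_ (norm_nonneg v))
      have := hL.norm_sub_le (z + t • v) z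
      rwa [add_sub_cancel_left, norm_smul, Real.norm_of_nonneg ht.1.le] at this
    rw [inner_sub_left] at h1
    nlinarith
  have := hanti (left_mem_Icc.2 zero_le_one) (right_mem_Icc.2 zero_le_one) zero_le_one
  simp only [h_def, one_smul, zero_smul, add_zero, one_mul, zero_mul, one_pow, ne_eq, OfNat.ofNat_ne_zero,
    not_false_eq_true, zero_pow, sub_zero] at this
  linarith

/-- A convex function lies above its tangent by the squared change of the gradient: compare the
convexity bound and the descent lemma at the point reached from `z` by a gradient step of
`f - ⟪∇ f w, ·⟫`. -/
lemma norm_gradient_sub_sq_le {f : E → ℝ} {L : ℝ≥0} (hf : ConvexOn ℝ univ f)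
    (hd : Differentiable ℝ f) (hL : LipschitzWith L (gradient f)) (w z : E) :
    ‖gradient f z - gradient f w‖ ^ 2 ≤ 2 * L * (f z - f w - inner ℝ (gradient f w) (z - w)) := by
  rcases eq_or_ne L 0 with rfl | hL0
  · have := hL.norm_sub_le z w
    simp only [NNReal.coe_zero, zero_mul, norm_le_zero_iff] at this
    simp [this]
  have hLpos : (0 : ℝ) < L := by exact_mod_cast pos_iff_ne_zero.2 hL0
  set r := gradient f z - gradient f w with hr
  have h1 := le_add_inner_add_of_lipschitz_gradient hd hL z (-(L : ℝ)⁻¹ • r)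
  have h2 := hf.add_inner_le (hd w).hasGradientAt (z + -(L : ℝ)⁻¹ • r)
  have h3 : z + -(L : ℝ)⁻¹ • r - w = (z - w) + -(L : ℝ)⁻¹ • r := by abel
  have h4 : inner ℝ (gradient f z) r - inner ℝ (gradient f w) r = ‖r‖ ^ 2 := by
    rw [← inner_sub_left, ← hr, real_inner_self_eq_norm_sq]
  rw [h3, inner_add_right] at h2
  simp only [inner_smul_right, norm_smul, norm_neg, norm_inv, Real.norm_of_nonneg hLpos.le] at h1 h2
  have h5 : ((L : ℝ)⁻¹ * ‖r‖) ^ 2 = (L : ℝ)⁻¹ * (L : ℝ)⁻¹ * ‖r‖ ^ 2 := by ring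
  have h6 : (L : ℝ) / 2 * ((L : ℝ)⁻¹ * (L : ℝ)⁻¹ * ‖r‖ ^ 2) = (L : ℝ)⁻¹ * ‖r‖ ^ 2 / 2 := by
    field_simp
  rw [h5, h6] at h1
  have h7 : (L : ℝ)⁻¹ * ‖r‖ ^ 2 / 2 ≤ f z - f w - inner ℝ (gradient f w) (z - w) := by
    rw [← h4]; rw [← h4] at h1; linarith
  calc ‖r‖ ^ 2 = 2 * L * ((L : ℝ)⁻¹ * ‖r‖ ^ 2 / 2) := by field_simp
    _ ≤ _ := by gcongr

/-- Co-coercivity (Baillon–Haddad) of the gradient of a convex smooth function. -/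
lemma norm_gradient_sub_sq_le_inner {f : E → ℝ} {L : ℝ≥0} (hf : ConvexOn ℝ univ f)
    (hd : Differentiable ℝ f) (hL : LipschitzWith L (gradient f)) (w z : E) :
    ‖gradient f z - gradient f w‖ ^ 2 ≤ L * inner ℝ (gradient f z - gradient f w) (z - w) := by
  have h1 := norm_gradient_sub_sq_le hf hd hL w z
  have h2 := norm_gradient_sub_sq_le hf hd hL z w
  rw [norm_sub_rev, ← neg_sub z w, inner_neg_right] at h2
  rw [inner_sub_left]
  linarith

end ConvexAnalysis

/-! ### The minimizer of the objective -/

variable {n m d : ℕ}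

lemma average_add_smul (x v : Fin n → Vec d) (t : ℝ) :
    average (fun i => x i + t • v i) = average x + t • average v := by
  simp only [average, Finset.sum_add_distrib, ← Finset.smul_sum, smul_add]
  rw [smul_comm]

lemma average_sub (x y : Fin n → Vec d) :
    average (fun i => x i - y i) = average x - average y := by
  simp only [average, Finset.sum_sub_distrib, smul_sub]

lemma sum_sub_average [NeZero n] (x : Fin n → Vec d) : ∑ i, (x i - average x) = 0 := by
  have hn : (n : ℝ) ≠ 0 := NeZero.ne _
  rw [Finset.sum_sub_distrib, Finset.sum_const, Finset.card_univ, Fintype.card_fin, average,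
    ← Nat.cast_smul_eq_nsmul ℝ, smul_smul, mul_inv_cancel₀ hn, one_smul, sub_self]

lemma sum_inner_sub_average [NeZero n] (x : Fin n → Vec d) :
    ∑ i, inner ℝ (x i - average x) (x i) = ∑ i, ‖x i - average x‖ ^ 2 := by
  have h : ∑ i, inner ℝ (x i - average x) (average x) = 0 := by
    rw [← sum_inner, sum_sub_average, inner_zero_left]
  rw [← sub_zero (∑ i, inner ℝ (x i - average x) (x i)), ← h, ← Finset.sum_sub_distrib]
  exact Finset.sum_congr rfl fun i _ => by rw [← inner_sub_right, real_inner_self_eq_norm_sq]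

/-- The gradient `∇fᵢ = (1/m) ∑ⱼ ∇f'ᵢⱼ` of the loss of device `i`. -/
noncomputable def localGradient (φ : Fin n → Fin m → Vec d → ℝ) (i : Fin n) (z : Vec d) : Vec d :=
  (m : ℝ)⁻¹ • ∑ j, gradient (φ i j) z

lemma hasGradientAt_localLoss {φ : Fin n → Fin m → Vec d → ℝ}
    (hdiff : ∀ i j, Differentiable ℝ (φ i j)) (i : Fin n) (z : Vec d) :
    HasGradientAt (localLoss φ i) (localGradient φ i z) z := by
  rw [hasGradientAt_iff_hasFDerivAt]
  have h := HasFDerivAt.fun_sum (u := Finset.univ) fun (j : Fin m) _ =>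
    hasGradientAt_iff_hasFDerivAt.1 (hdiff i j z).hasGradientAt
  have hsum : InnerProductSpace.toDual ℝ (Vec d) (localGradient φ i z)
      = (m : ℝ)⁻¹ • ∑ j, InnerProductSpace.toDual ℝ (Vec d) (gradient (φ i j) z) := by
    rw [localGradient, map_smulₛₗ, map_sum]
    simp
  rw [hsum]
  exact h.const_mul (m : ℝ)⁻¹

lemma continuous_objective (lam : ℝ) {φ : Fin n → Fin m → Vec d → ℝ}
    (hdiff : ∀ i j, Differentiable ℝ (φ i j)) : Continuous (objective lam φ) := by
  have h : ∀ i j, Continuous (φ i j) := fun i j => (hdiff i j).continuous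
  unfold objective localLoss average
  fun_prop

/-- The objective is coercive, by the quadratic lower bounds of the local losses at the origin. -/
lemma tendsto_objective_cocompact [NeZero n] {lam μ : ℝ} (hlam : 0 ≤ lam) (hμ : 0 < μ)
    {φ : Fin n → Fin m → Vec d → ℝ} (hdiff : ∀ i j, Differentiable ℝ (φ i j))
    (hstrong : ∀ i, StrongConvexOn univ μ (localLoss φ i)) :
    Filter.Tendsto (objective lam φ) (Filter.cocompact _) Filter.atTop := by
  have hn : (0 : ℝ) < n := Nat.cast_pos.2 (NeZero.pos n)
  set c : Fin n → ℝ := fun i => localLoss φ i 0 - ‖localGradient φ i 0‖ ^ 2 / μ with hc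
  have hloc : ∀ i z, c i + μ / 4 * ‖z‖ ^ 2 ≤ localLoss φ i z := by
    intro i z
    have h1 := StrongConvexOn.add_inner_add_le (hstrong i) (hasGradientAt_localLoss hdiff i 0) z
    rw [sub_zero] at h1
    have h2 : -(‖localGradient φ i 0‖ * ‖z‖) ≤ inner ℝ (localGradient φ i 0) z :=
      neg_le_of_abs_le (abs_real_inner_le_norm _ _)
    -- Young's inequality: half of the quadratic growth absorbs the linear term.
    have h3 : ‖localGradient φ i 0‖ * ‖z‖ ≤ ‖localGradient φ i 0‖ ^ 2 / μ + μ / 4 * ‖z‖ ^ 2 := by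
      rw [← sub_nonneg]
      have : ‖localGradient φ i 0‖ ^ 2 / μ + μ / 4 * ‖z‖ ^ 2 - ‖localGradient φ i 0‖ * ‖z‖
          = (‖localGradient φ i 0‖ - μ / 2 * ‖z‖) ^ 2 / μ := by
        field_simp
        ring
      rw [this]
      positivity
    simp only [hc]
    linarith
  have hbound : ∀ x : Fin n → Vec d,
      (n : ℝ)⁻¹ * (∑ i, c i) + (n : ℝ)⁻¹ * (μ / 4) * ‖x‖ ^ 2 ≤ objective lam φ x := by
    intro x
    -- The product space carries the sup norm, which is dominated by the Euclidean one.
    have hsup : ‖x‖ ^ 2 ≤ ∑ i, ‖x i‖ ^ 2 := by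
      have h : ‖x‖ ≤ √(∑ i, ‖x i‖ ^ 2) :=
        (pi_norm_le_iff_of_nonneg (Real.sqrt_nonneg _)).2 fun i => Real.le_sqrt_of_sq_le
          (Finset.single_le_sum (f := fun i => ‖x i‖ ^ 2) (fun _ _ => by positivity)
            (Finset.mem_univ i))
      exact (Real.le_sqrt (norm_nonneg x) (by positivity)).1 h
    have h1 : ∑ i, (c i + μ / 4 * ‖x i‖ ^ 2) ≤ ∑ i, localLoss φ i (x i) :=
      Finset.sum_le_sum fun i _ => hloc i (x i)
    rw [Finset.sum_add_distrib, ← Finset.mul_sum] at h1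
    have h2 : 0 ≤ lam * ((2 * (n : ℝ))⁻¹ * ∑ i, ‖x i - average x‖ ^ 2) := by positivity
    unfold objective
    calc (n : ℝ)⁻¹ * (∑ i, c i) + (n : ℝ)⁻¹ * (μ / 4) * ‖x‖ ^ 2
        = (n : ℝ)⁻¹ * (∑ i, c i + μ / 4 * ‖x‖ ^ 2) := by ring
      _ ≤ (n : ℝ)⁻¹ * ∑ i, localLoss φ i (x i) := by
          gcongr
          nlinarith
      _ ≤ _ := le_add_of_nonneg_right h2
  refine Filter.tendsto_atTop_mono hbound (Filter.tendsto_atTop_add_const_left _ _ ?_)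
  exact ((Filter.tendsto_pow_atTop two_ne_zero).comp
    (tendsto_norm_cocompact_atTop (E := Fin n → Vec d))).const_mul_atTop (by positivity)

lemma exists_isMinOn_objective [NeZero n] {lam μ : ℝ} (hlam : 0 ≤ lam) (hμ : 0 < μ)
    {φ : Fin n → Fin m → Vec d → ℝ} (hdiff : ∀ i j, Differentiable ℝ (φ i j))
    (hstrong : ∀ i, StrongConvexOn univ μ (localLoss φ i)) :
    ∃ xs, IsMinOn (objective lam φ) univ xs := by
  obtain ⟨xs, hxs⟩ := (continuous_objective lam hdiff).exists_forall_le
    (tendsto_objective_cocompact hlam hμ hdiff hstrong)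
  exact ⟨xs, fun y _ => hxs y⟩

/-- The first-order condition `∇fᵢ(xᵢ) + λ (xᵢ - x̄) = 0` at a minimizer, obtained from the
derivative of the objective in the direction of its own gradient. -/
lemma localGradient_add_eq_zero [NeZero n] {lam : ℝ} {φ : Fin n → Fin m → Vec d → ℝ}
    (hdiff : ∀ i j, Differentiable ℝ (φ i j)) {x : Fin n → Vec d}
    (hx : IsMinOn (objective lam φ) univ x) (i : Fin n) :
    localGradient φ i (x i) + lam • (x i - average x) = 0 := by
  have hn : (0 : ℝ) < n := Nat.cast_pos.2 (NeZero.pos n)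
  set r : Fin n → Vec d := fun i => localGradient φ i (x i) + lam • (x i - average x) with hr
  have hd1 : HasDerivAt (fun t : ℝ => ∑ i, localLoss φ i (x i + t • r i))
      (∑ i, inner ℝ (localGradient φ i (x i)) (r i)) 0 :=
    HasDerivAt.fun_sum fun i _ => hasDerivAt_comp_line
      (by simpa using hasGradientAt_localLoss hdiff i (x i))
  have hd2 : HasDerivAt
      (fun t : ℝ => ∑ i, ‖x i + t • r i - average (fun i => x i + t • r i)‖ ^ 2)
      (∑ i, 2 * inner ℝ (x i - average x) (r i - average r)) 0 := by
    refine HasDerivAt.fun_sum fun i _ => ?_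
    have h1 : HasDerivAt (fun t : ℝ => x i - average x + t • (r i - average r))
        (r i - average r) 0 := by
      simpa using ((hasDerivAt_id (0 : ℝ)).smul_const (r i - average r)).const_add
        (x i - average x)
    have h2 : (fun t : ℝ => x i + t • r i - average (fun i => x i + t • r i))
        = fun t : ℝ => x i - average x + t • (r i - average r) := by
      funext t
      rw [average_add_smul, smul_sub]
      abel
    rw [← h2] at h1
    have h3 := h1.norm_sq
    simpa [average_add_smul] using h3
  have hd := (hd1.const_mul (n : ℝ)⁻¹).add ((hd2.const_mul (2 * (n : ℝ))⁻¹).const_mul lam)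
  have hmin : IsLocalMin (fun t : ℝ => objective lam φ (fun i => x i + t • r i)) 0 := by
    refine Filter.Eventually.of_forall fun t => ?_
    simpa using hx (mem_univ (fun i => x i + t • r i))
  have h0 := hmin.hasDerivAt_eq_zero hd
  have hsum : ∑ i, 2 * inner ℝ (x i - average x) (r i - average r)
      = 2 * ∑ i, inner ℝ (x i - average x) (r i) := by
    rw [← Finset.mul_sum]
    simp only [inner_sub_right _ (r _), Finset.sum_sub_distrib]
    rw [← sum_inner _ _ (average r), sum_sub_average, inner_zero_left, sub_zero]
  rw [hsum] at h0
  have hzero : ∑ i, ‖r i‖ ^ 2 = 0 := by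
    have h1 : ∑ i, ‖r i‖ ^ 2 = ∑ i, inner ℝ (localGradient φ i (x i)) (r i)
        + lam * ∑ i, inner ℝ (x i - average x) (r i) := by
      rw [Finset.mul_sum, ← Finset.sum_add_distrib]
      refine Finset.sum_congr rfl fun i _ => ?_
      rw [← real_inner_smul_left, ← inner_add_left, real_inner_self_eq_norm_sq]
    rw [h1]
    field_simp at h0
    linarith
  have := (Finset.sum_eq_zero_iff_of_nonneg fun i _ => by positivity).1 hzero i (Finset.mem_univ i)
  simpa using this

/-- Strong monotonicity of the gradient of the local losses, summed over the devices. -/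
lemma mul_sum_norm_sub_sq_le {μ : ℝ} {φ : Fin n → Fin m → Vec d → ℝ}
    (hdiff : ∀ i j, Differentiable ℝ (φ i j))
    (hstrong : ∀ i, StrongConvexOn univ μ (localLoss φ i)) (x y : Fin n → Vec d) :
    μ * ∑ i, ‖x i - y i‖ ^ 2
      ≤ ∑ i, inner ℝ (localGradient φ i (x i) - localGradient φ i (y i)) (x i - y i) := by
  rw [Finset.mul_sum]
  exact Finset.sum_le_sum fun i _ => StrongConvexOn.mul_norm_sub_sq_le_inner (hstrong i)
    (hasGradientAt_localLoss hdiff i _) (hasGradientAt_localLoss hdiff i _)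

lemma isMinOn_objective_unique [NeZero n] {lam μ : ℝ} (hlam : 0 ≤ lam) (hμ : 0 < μ)
    {φ : Fin n → Fin m → Vec d → ℝ} (hdiff : ∀ i j, Differentiable ℝ (φ i j))
    (hstrong : ∀ i, StrongConvexOn univ μ (localLoss φ i)) {x y : Fin n → Vec d}
    (hx : IsMinOn (objective lam φ) univ x) (hy : IsMinOn (objective lam φ) univ y) : x = y := by
  have h1 := mul_sum_norm_sub_sq_le hdiff hstrong x y
  have h2 := sum_inner_sub_average fun i => x i - y i
  -- Subtracting the first-order conditions turns the monotone term into a nonpositive one.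
  have h3 : ∑ i, inner ℝ (localGradient φ i (x i) - localGradient φ i (y i)) (x i - y i)
      = -lam * ∑ i, inner ℝ (x i - y i - average fun i => x i - y i) (x i - y i) := by
    rw [Finset.mul_sum]
    refine Finset.sum_congr rfl fun i _ => ?_
    rw [← real_inner_smul_left, eq_neg_of_add_eq_zero_left (localGradient_add_eq_zero hdiff hx i),
      eq_neg_of_add_eq_zero_left (localGradient_add_eq_zero hdiff hy i), average_sub]
    congr 1
    module
  rw [h3, h2] at h1
  have h4 : 0 ≤ lam * ∑ i, ‖x i - y i - average fun i => x i - y i‖ ^ 2 := by positivity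
  have h5 : 0 ≤ ∑ i, ‖x i - y i‖ ^ 2 := by positivity
  have h6 : ∑ i, ‖x i - y i‖ ^ 2 = 0 := by
    refine le_antisymm ?_ h5
    by_contra hneg
    have := mul_pos hμ (not_le.1 hneg)
    linarith
  funext i
  have := (Finset.sum_eq_zero_iff_of_nonneg fun i _ => by positivity).1 h6 i (Finset.mem_univ i)
  exact sub_eq_zero.1 (by simpa using this)

/-! ### Integration over independent draws -/

section FiniteDraws

lemma exists_factor_of_dependsOn {X : Type*} {f : (ℕ → X) → ℝ} {k : ℕ} (hf : DependsOn f (Iio k)) :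
    ∃ g : (Finset.range k → X) → ℝ, f = fun ω => g fun i => ω i := by
  have h : f.FactorsThrough fun (ω : ℕ → X) (i : Finset.range k) => ω i := fun ω ω' hω =>
    hf fun i hi => congrFun hω ⟨i, Finset.mem_range.2 hi⟩
  exact ⟨Function.extend (fun (ω : ℕ → X) (i : Finset.range k) => ω i) f fun _ => 0,
    (h.extend_comp _).symm⟩

variable {X : Type*} [Finite X] [MeasurableSpace X] [MeasurableSingletonClass X]
  {ν : Measure X} [IsProbabilityMeasure ν]

lemma integrable_infinitePi_of_dependsOn {f : (ℕ → X) → ℝ} {k : ℕ} (hf : DependsOn f (Iio k)) :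
    Integrable f (Measure.infinitePi fun _ : ℕ => ν) := by
  obtain ⟨g, rfl⟩ := exists_factor_of_dependsOn hf
  have hm : Measurable fun (ω : ℕ → X) (i : Finset.range k) => ω i := by fun_prop
  obtain ⟨C, hC⟩ := (Set.finite_range fun r => ‖g r‖).bddAbove
  exact Integrable.of_bound ((measurable_of_finite g).comp hm).aestronglyMeasurable C
    (Filter.Eventually.of_forall fun ω => hC ⟨_, rfl⟩)

/-- The draw number `k` is independent of everything determined by the earlier draws, so it may be
integrated out first. -/
lemma integral_infinitePi_of_dependsOn {F : (ℕ → X) → X → ℝ} {k : ℕ}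
    (hF : ∀ x, DependsOn (fun ω => F ω x) (Iio k)) :
    ∫ ω, F ω (ω k) ∂(Measure.infinitePi fun _ : ℕ => ν)
      = ∫ ω, ∫ x, F ω x ∂ν ∂(Measure.infinitePi fun _ : ℕ => ν) := by
  classical
  have := Fintype.ofFinite X
  set P := Measure.infinitePi fun _ : ℕ => ν with hP
  -- Splitting by the value of draw `k` leaves products of independent factors.
  have hsplit : ∀ ω : ℕ → X, F ω (ω k) = ∑ x, F ω x * (if ω k = x then 1 else 0) := by
    intro ω
    simp
  have hind : ∀ x, ProbabilityTheory.IndepFun (fun ω : ℕ → X => F ω x)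
      (fun ω => if ω k = x then (1 : ℝ) else 0) P := by
    intro x
    obtain ⟨g, hg⟩ := exists_factor_of_dependsOn (hF x)
    have h0 : ProbabilityTheory.iIndepFun (fun (i : ℕ) (ω : ℕ → X) => ω i) P :=
      ProbabilityTheory.iIndepFun_infinitePi (X := fun _ => id) fun _ => measurable_id
    have h1 := h0.indepFun_finset (Finset.range k) {k} (by simp) fun i => by fun_prop
    have h2 := h1.comp (φ := g)
      (ψ := fun r => if r ⟨k, Finset.mem_singleton_self k⟩ = x then (1 : ℝ) else 0)
      (measurable_of_finite _) (measurable_of_finite _)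
    rw [hg]
    exact h2
  have hI : ∀ x, Measurable fun ω : ℕ → X => if ω k = x then (1 : ℝ) else 0 := fun x =>
    (measurable_of_finite fun y => if y = x then (1 : ℝ) else 0).comp (measurable_pi_apply k)
  have hInt : ∀ x, Integrable (fun ω => F ω x) P := fun x =>
    integrable_infinitePi_of_dependsOn (hF x)
  have hcoord : ∀ x, ∫ ω, (if ω k = x then (1 : ℝ) else 0) ∂P = ν.real {x} := by
    intro x
    have h := integral_map (μ := P) (φ := fun ω => ω k)
      (measurable_pi_apply k).aemeasurable
      (f := fun y => if y = x then (1 : ℝ) else 0) (measurable_of_finite _).aestronglyMeasurable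
    rw [hP, Measure.infinitePi_map_eval, ← hP] at h
    rw [← h, integral_fintype .of_finite]
    simp
  have hmul : ∀ x, ∫ ω, F ω x * (if ω k = x then 1 else 0) ∂P
      = (∫ ω, F ω x ∂P) * ν.real {x} := by
    intro x
    rw [(hind x).integral_fun_mul_eq_mul_integral (hInt x).aestronglyMeasurable
      (hI x).aestronglyMeasurable, hcoord]
  simp_rw [hsplit]
  rw [integral_finsetSum]
  · simp_rw [integral_fintype (μ := ν) .of_finite, hmul]
    rw [integral_finsetSum (f := fun x ω => ν.real {x} • F ω x) _
      fun x _ => (hInt x).smul (ν.real {x})]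
    refine Finset.sum_congr rfl fun x _ => ?_
    rw [integral_smul, smul_eq_mul, mul_comm]
  · refine fun x _ => (hInt x).mul_bdd (c := 1) (hI x).aestronglyMeasurable ?_
    refine Filter.Eventually.of_forall fun ω => ?_
    split_ifs <;> simp

end FiniteDraws

lemma isProbabilityMeasure_coinLaw {p : ℝ} (hp : p ∈ Ioo (0 : ℝ) 1) :
    IsProbabilityMeasure (coinLaw p) := by
  refine ⟨?_⟩
  simp only [coinLaw, Measure.add_apply, Measure.smul_apply, measure_univ, smul_eq_mul, mul_one]
  rw [← ENNReal.ofReal_add hp.1.le (sub_nonneg.2 hp.2.le)]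
  simp

lemma isProbabilityMeasure_drawLaw [NeZero m] {p : ℝ} (hp : p ∈ Ioo (0 : ℝ) 1) :
    IsProbabilityMeasure (drawLaw n m p) := by
  have := isProbabilityMeasure_coinLaw hp
  unfold drawLaw
  infer_instance

lemma integral_coinLaw {p : ℝ} (hp : p ∈ Ioo (0 : ℝ) 1) (f : Bool → ℝ) :
    ∫ b, f b ∂(coinLaw p) = p * f true + (1 - p) * f false := by
  have hint : ∀ c : ℝ≥0∞, c ≠ ∞ → ∀ b, Integrable f (c • Measure.dirac b) := fun c hc b =>
    Integrable.smul_measure .of_finite hc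
  rw [coinLaw, integral_add_measure (hint _ ENNReal.ofReal_ne_top _)
    (hint _ ENNReal.ofReal_ne_top _), integral_smul_measure,
    integral_smul_measure, integral_dirac, integral_dirac, ENNReal.toReal_ofReal hp.1.le,
    ENNReal.toReal_ofReal (sub_nonneg.2 hp.2.le), smul_eq_mul, smul_eq_mul]

/-- The expectation of a quantity that depends on the coin and on the index sampled by one
device. -/
lemma integral_drawLaw [NeZero m] {p : ℝ} (hp : p ∈ Ioo (0 : ℝ) 1) (i : Fin n)
    (f : Bool → Fin m → ℝ) :
    ∫ w, f w.1 (w.2 i) ∂(drawLaw n m p)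
      = p * ((m : ℝ)⁻¹ * ∑ j, f true j) + (1 - p) * ((m : ℝ)⁻¹ * ∑ j, f false j) := by
  have := isProbabilityMeasure_coinLaw hp
  have hpi : ∀ b, ∫ w : Fin n → Fin m, f b (w i)
      ∂(Measure.pi fun _ : Fin n => (PMF.uniformOfFintype (Fin m)).toMeasure)
      = (m : ℝ)⁻¹ * ∑ j, f b j := by
    intro b
    have h := (measurePreserving_eval
      (fun _ : Fin n => (PMF.uniformOfFintype (Fin m)).toMeasure) i).map_eq
    rw [← integral_map (φ := fun w : Fin n → Fin m => w i) (f := f b)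
      (measurable_pi_apply i).aemeasurable
      (measurable_of_finite _).aestronglyMeasurable]
    have h' : Measure.map (fun w : Fin n → Fin m => w i)
      (Measure.pi fun _ : Fin n => (PMF.uniformOfFintype (Fin m)).toMeasure)
      = (PMF.uniformOfFintype (Fin m)).toMeasure := h
    rw [h', PMF.integral_eq_sum, Finset.mul_sum]
    simp
  rw [drawLaw, integral_prod _ .of_finite]
  simp only [hpi]
  exact integral_coinLaw hp _

/-! ### The number of communication rounds -/

lemma expectedCommRounds_eq [NeZero m] {p : ℝ} (hp : p ∈ Ioo (0 : ℝ) 1) (k : ℕ) :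
    expectedCommRounds n m p k = p * (1 - p) * k := by
  have := isProbabilityMeasure_drawLaw (n := n) (m := m) hp
  have := isProbabilityMeasure_coinLaw hp
  have hcoin : ∀ f : Bool → ℝ, ∫ w, f w.1 ∂(drawLaw n m p) = p * f true + (1 - p) * f false := by
    intro f
    rw [← integral_coinLaw hp f, drawLaw, integral_fun_fst]
    simp
  have hround : ∀ l, DependsOn (fun ω : ℕ → Draw n m =>
      if (ω l).1 = true ∧ (ω (l + 1)).1 = false then (1 : ℝ) else 0) (Iio (l + 2)) := by
    intro l ω ω' h
    simp only [h l (by simp), h (l + 1) (by simp)]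
  have hterm : ∀ l, ∫ ω : ℕ → Draw n m,
      (if (ω l).1 = true ∧ (ω (l + 1)).1 = false then (1 : ℝ) else 0) ∂(runLaw n m p)
      = p * (1 - p) := by
    intro l
    rw [runLaw, integral_infinitePi_of_dependsOn (k := l + 1)
      (F := fun (ω : ℕ → Draw n m) (x : Draw n m) => if (ω l).1 = true ∧ x.1 = false then (1 : ℝ) else 0)]
    · have h1 : ∀ ω : ℕ → Draw n m,
          ∫ x : Draw n m, (if (ω l).1 = true ∧ x.1 = false then (1 : ℝ) else 0) ∂(drawLaw n m p)
          = if (ω l).1 = true then 1 - p else 0 := by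
        intro ω
        rw [hcoin fun b => if (ω l).1 = true ∧ b = false then (1 : ℝ) else 0]
        simp
      simp_rw [h1]
      rw [integral_infinitePi_of_dependsOn (k := l)
        (F := fun (_ : ℕ → Draw n m) (x : Draw n m) => if x.1 = true then 1 - p else 0) fun x => fun _ _ _ => rfl]
      rw [hcoin fun b => if b = true then 1 - p else 0]
      simp
    · intro x ω ω' h
      simp only [h l (by simp)]
  unfold expectedCommRounds
  have hcard : ∀ ω : ℕ → Draw n m, (commRounds ω k : ℝ)
      = ∑ l ∈ Finset.range k, if (ω l).1 = true ∧ (ω (l + 1)).1 = false then (1 : ℝ) else 0 := by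
    intro ω
    simp [commRounds]
  simp_rw [hcard]
  rw [runLaw]
  rw [integral_finsetSum _ fun l _ => integrable_infinitePi_of_dependsOn (hround l)]
  rw [← runLaw]
  simp_rw [hterm]
  simp [mul_comm]

/-! ### The mean and the second moment of the search direction -/

section SingleDevice

variable {E : Type*} [NormedAddCommGroup E] [InnerProductSpace ℝ E] {m : ℕ}

/-- The variance of a random vector is at most its second moment. The vector is `Z₁` with
probability `p`, and otherwise `Z₀ j` for a uniform `j`. -/
lemma mean_norm_sub_mean_sq_le [NeZero m] {p : ℝ} {Z₁ e : E} {Z₀ : Fin m → E}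
    (he : p • Z₁ + (1 - p) • ((m : ℝ)⁻¹ • ∑ j, Z₀ j) = e) :
    p * ‖Z₁ - e‖ ^ 2 + (1 - p) * ((m : ℝ)⁻¹ * ∑ j, ‖Z₀ j - e‖ ^ 2)
      ≤ p * ‖Z₁‖ ^ 2 + (1 - p) * ((m : ℝ)⁻¹ * ∑ j, ‖Z₀ j‖ ^ 2) := by
  have hm : (m : ℝ) ≠ 0 := NeZero.ne _
  have h1 : p * inner ℝ Z₁ e + (1 - p) * ((m : ℝ)⁻¹ * ∑ j, inner ℝ (Z₀ j) e) = ‖e‖ ^ 2 := by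
    rw [← real_inner_self_eq_norm_sq]
    nth_rewrite 3 [← he]
    simp only [inner_add_left, real_inner_smul_left, sum_inner]
  have h2 : ∑ j, ‖Z₀ j - e‖ ^ 2
      = ∑ j, ‖Z₀ j‖ ^ 2 - 2 * ∑ j, inner ℝ (Z₀ j) e + m * ‖e‖ ^ 2 := by
    simp [norm_sub_sq_real, Finset.sum_add_distrib, Finset.mul_sum]
  have h3 : (m : ℝ)⁻¹ * ∑ j, ‖Z₀ j - e‖ ^ 2 = (m : ℝ)⁻¹ * ∑ j, ‖Z₀ j‖ ^ 2
      - 2 * ((m : ℝ)⁻¹ * ∑ j, inner ℝ (Z₀ j) e) + ‖e‖ ^ 2 := by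
    rw [h2]
    field_simp
  rw [h3, norm_sub_sq_real]
  nlinarith [sq_nonneg ‖e‖]

lemma norm_sub_sq_le_two_mul (u v : E) : ‖u - v‖ ^ 2 ≤ 2 * (‖u‖ ^ 2 + ‖v‖ ^ 2) := by
  have h := parallelogram_law_with_norm ℝ u v
  nlinarith [mul_self_nonneg ‖u + v‖]

variable {N p : ℝ} {a J h : Fin m → E} {c Ψ ψ g₁ : E} {g₀ : Fin m → E}

/-- The search direction is an unbiased estimator of the gradient of the objective. -/
lemma mean_direction [NeZero m] (hp : p ∈ Ioo (0 : ℝ) 1)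
    (hg₀ : ∀ j, g₀ j = (1 / (N * (1 - p))) • (a j - J j) + (1 / (N * m)) • (∑ j, J j)
      + (1 / N) • Ψ)
    (hg₁ : g₁ = (1 / (N * p)) • c - ((p⁻¹ - 1) / N) • Ψ + (1 / (N * m)) • (∑ j, J j)) :
    p • g₁ + (1 - p) • ((m : ℝ)⁻¹ • ∑ j, g₀ j) = N⁻¹ • ((m : ℝ)⁻¹ • ∑ j, a j + c) := by
  have hm : (m : ℝ) ≠ 0 := NeZero.ne _
  have hp0 : p ≠ 0 := hp.1.ne'
  have hq0 : 1 - p ≠ 0 := (sub_pos.2 hp.2).ne'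
  have hsum : ∑ j, g₀ j = (1 / (N * (1 - p))) • (∑ j, a j - ∑ j, J j)
      + (m : ℝ) • ((1 / (N * m)) • (∑ j, J j) + (1 / N) • Ψ) := by
    simp only [hg₀, Finset.sum_add_distrib, ← Finset.smul_sum, Finset.sum_sub_distrib]
    simp only [Finset.sum_const, Finset.card_univ, Fintype.card_fin, ← Nat.cast_smul_eq_nsmul ℝ,
      smul_add]
    rw [smul_comm (m : ℝ) (1 / (N * m)), smul_comm (m : ℝ) (1 / N), add_assoc]
  rw [hsum, hg₁]
  rcases eq_or_ne N 0 with rfl | hN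
  · simp
  match_scalars <;> field_simp <;> ring

/-- The search direction is the rescaled deviation of the sampled gradient from its value at the
optimum, minus the centred deviation of the sampled control variate; the variance of the latter is
at most its second moment. -/
lemma mean_norm_direction_sq_le [NeZero m] (hp : p ∈ Ioo (0 : ℝ) 1)
    (hψ : (m : ℝ)⁻¹ • ∑ j, h j + ψ = 0)
    (hg₀ : ∀ j, g₀ j = (1 / (N * (1 - p))) • (a j - J j) + (1 / (N * m)) • (∑ j, J j)
      + (1 / N) • Ψ)
    (hg₁ : g₁ = (1 / (N * p)) • c - ((p⁻¹ - 1) / N) • Ψ + (1 / (N * m)) • (∑ j, J j)) :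
    p * ‖g₁‖ ^ 2 + (1 - p) * ((m : ℝ)⁻¹ * ∑ j, ‖g₀ j‖ ^ 2)
      ≤ 2 / N ^ 2 * ((∑ j, ‖a j - h j‖ ^ 2 + ∑ j, ‖J j - h j‖ ^ 2) / ((1 - p) * m)
        + (‖c - ψ‖ ^ 2 + ‖Ψ - ψ‖ ^ 2) / p) := by
  have hm : (0 : ℝ) < m := Nat.cast_pos.2 (NeZero.pos m)
  have hp0 : 0 < p := hp.1
  have hq0 : 0 < 1 - p := sub_pos.2 hp.2
  rcases eq_or_ne N 0 with rfl | hN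
  · simp [hg₀, hg₁]
  set e : E := (m : ℝ)⁻¹ • ∑ j, J j + Ψ with he
  -- `e` is the mean of the sampled control variate; its deviation from the value at the optimum has
  -- the same mean, because that value has mean `0` by `hψ`.
  have h0 : ∀ j, g₀ j = N⁻¹ • ((1 - p)⁻¹ • (a j - h j) - ((1 - p)⁻¹ • (J j - h j) - e)) := by
    intro j
    rw [hg₀, he]
    match_scalars <;> field_simp
    ring
  have h1 : g₁ = N⁻¹ • (p⁻¹ • (c - ψ) - (p⁻¹ • (Ψ - ψ) - e)) := by
    rw [hg₁, he]
    match_scalars <;> field_simp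
    ring
  have hmean : p • (p⁻¹ • (Ψ - ψ)) + (1 - p) • ((m : ℝ)⁻¹ • ∑ j, (1 - p)⁻¹ • (J j - h j)) = e := by
    have : e = (m : ℝ)⁻¹ • ∑ j, J j + Ψ - ((m : ℝ)⁻¹ • ∑ j, h j + ψ) := by rw [hψ, sub_zero]
    rw [this, ← Finset.smul_sum, Finset.sum_sub_distrib]
    match_scalars <;> field_simp
  have hvar := mean_norm_sub_mean_sq_le hmean
  have hb1 : ‖g₁‖ ^ 2 ≤ 2 / N ^ 2 * (‖p⁻¹ • (c - ψ)‖ ^ 2 + ‖p⁻¹ • (Ψ - ψ) - e‖ ^ 2) := by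
    rw [h1, norm_smul, mul_pow, norm_inv, Real.norm_eq_abs, inv_pow, sq_abs, div_eq_mul_inv,
      mul_comm 2, mul_assoc]
    gcongr
    exact norm_sub_sq_le_two_mul _ _
  have hb0 : ∀ j, ‖g₀ j‖ ^ 2
      ≤ 2 / N ^ 2 * (‖(1 - p)⁻¹ • (a j - h j)‖ ^ 2 + ‖(1 - p)⁻¹ • (J j - h j) - e‖ ^ 2) := by
    intro j
    rw [h0, norm_smul, mul_pow, norm_inv, Real.norm_eq_abs, inv_pow, sq_abs, div_eq_mul_inv,
      mul_comm 2, mul_assoc]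
    gcongr
    exact norm_sub_sq_le_two_mul _ _
  have hs : ∀ (q : ℝ) (_ : 0 < q) (v : E), ‖q⁻¹ • v‖ ^ 2 = q⁻¹ ^ 2 * ‖v‖ ^ 2 := by
    intro q hq v
    rw [norm_smul, mul_pow, norm_inv, Real.norm_of_nonneg hq.le]
  calc p * ‖g₁‖ ^ 2 + (1 - p) * ((m : ℝ)⁻¹ * ∑ j, ‖g₀ j‖ ^ 2)
      ≤ p * (2 / N ^ 2 * (‖p⁻¹ • (c - ψ)‖ ^ 2 + ‖p⁻¹ • (Ψ - ψ) - e‖ ^ 2))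
        + (1 - p) * ((m : ℝ)⁻¹ * ∑ j, 2 / N ^ 2 * (‖(1 - p)⁻¹ • (a j - h j)‖ ^ 2
          + ‖(1 - p)⁻¹ • (J j - h j) - e‖ ^ 2)) := by
        gcongr with j
        exact hb0 j
    _ = 2 / N ^ 2 * (p * ‖p⁻¹ • (c - ψ)‖ ^ 2
          + (1 - p) * ((m : ℝ)⁻¹ * ∑ j, ‖(1 - p)⁻¹ • (a j - h j)‖ ^ 2)
          + (p * ‖p⁻¹ • (Ψ - ψ) - e‖ ^ 2
          + (1 - p) * ((m : ℝ)⁻¹ * ∑ j, ‖(1 - p)⁻¹ • (J j - h j) - e‖ ^ 2))) := by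
        rw [← Finset.mul_sum, Finset.sum_add_distrib]
        ring
    _ ≤ 2 / N ^ 2 * (p * ‖p⁻¹ • (c - ψ)‖ ^ 2
          + (1 - p) * ((m : ℝ)⁻¹ * ∑ j, ‖(1 - p)⁻¹ • (a j - h j)‖ ^ 2)
          + (p * ‖p⁻¹ • (Ψ - ψ)‖ ^ 2
          + (1 - p) * ((m : ℝ)⁻¹ * ∑ j, ‖(1 - p)⁻¹ • (J j - h j)‖ ^ 2))) := by
        gcongr
    _ = _ := by
        simp only [hs _ hp0, hs _ hq0, ← Finset.mul_sum]
        field_simp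
        ring

lemma mean_norm_sub_smul_sq [NeZero m] (α : ℝ) (y : E) :
    p * ‖y - α • g₁‖ ^ 2 + (1 - p) * ((m : ℝ)⁻¹ * ∑ j, ‖y - α • g₀ j‖ ^ 2)
      = ‖y‖ ^ 2 - 2 * α * inner ℝ (p • g₁ + (1 - p) • ((m : ℝ)⁻¹ • ∑ j, g₀ j)) y
        + α ^ 2 * (p * ‖g₁‖ ^ 2 + (1 - p) * ((m : ℝ)⁻¹ * ∑ j, ‖g₀ j‖ ^ 2)) := by
  have hm : (m : ℝ) ≠ 0 := NeZero.ne _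
  have hsq : ∀ g : E, ‖y - α • g‖ ^ 2 = ‖y‖ ^ 2 - 2 * α * inner ℝ g y + α ^ 2 * ‖g‖ ^ 2 := by
    intro g
    rw [norm_sub_sq_real, inner_smul_right, norm_smul, mul_pow, Real.norm_eq_abs, sq_abs,
      real_inner_comm]
    ring
  simp only [hsq, Finset.sum_add_distrib, Finset.sum_sub_distrib, ← Finset.mul_sum,
    inner_add_left, real_inner_smul_left, sum_inner, Finset.sum_const, Finset.card_univ,
    Fintype.card_fin, nsmul_eq_mul]
  field_simp
  ring

end SingleDevice

/-! ### Scalar inequalities behind the contraction -/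

/-- The balance of the gradient tables: half of the decrease `(2α/n) D` pays for the noise of the
gradient estimate, thanks to co-coercivity `A ≤ m L D`. -/
lemma table_balance {N m q α μ L D A U : ℝ} (hN : 0 < N) (hm : 0 < m) (hq : 0 < q) (hα : 0 < α)
    (hμ : 0 < μ) (hL : 0 ≤ L) (hstep : α * (4 * L + μ * m) ≤ N * q) (hA : 0 ≤ A) (hU : 0 ≤ U)
    (hD : 0 ≤ D) (hAD : A ≤ m * L * D) (hL0 : L = 0 → U = 0) :
    -(α / N) * D + 2 * α ^ 2 / N ^ 2 * ((A + U) / (q * m))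
        + α * (1 / (2 * N * q * L) * (U - q / m * (U - A)))
      ≤ (1 - α * μ / N) * (α * (1 / (2 * N * q * L) * U)) := by
  rcases hL.eq_or_lt with rfl | hLpos
  · have hA0 : A = 0 := le_antisymm (by simpa using hAD) hA
    have : 0 ≤ α / N * D := by positivity
    simp [hL0 rfl, hA0]
    linarith
  have h1 : 0 ≤ D - A / (m * L) := by
    rw [sub_nonneg, div_le_iff₀ (by positivity)]
    linarith
  have h2 : 0 ≤ N * q - 4 * α * L := by
    have : 0 < α * (μ * m) := by positivity
    linarith
  have h3 : 0 ≤ N * q - α * (4 * L + μ * m) := sub_nonneg.2 hstep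
  rw [← sub_nonneg]
  have key : (1 - α * μ / N) * (α * (1 / (2 * N * q * L) * U))
      - (-(α / N) * D + 2 * α ^ 2 / N ^ 2 * ((A + U) / (q * m))
        + α * (1 / (2 * N * q * L) * (U - q / m * (U - A))))
      = α / N * (D - A / (m * L)) + A * (α / (2 * N ^ 2 * m * L * q)) * (N * q - 4 * α * L)
        + U * (α / (2 * N ^ 2 * q * L * m)) * (N * q - α * (4 * L + μ * m)) := by
    field_simp
    ring
  rw [key]
  positivity

/-- The balance of the control variates of the penalty, where `S` is `∑ᵢ ‖yᵢ - ȳ‖²`. -/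
lemma control_balance {N p α μ lam S V : ℝ} (hN : 0 < N) (hp : 0 < p) (hα : 0 < α)
    (hμ : 0 < μ) (hlam : 0 ≤ lam) (hstep : α * (4 * lam + μ) ≤ N * p) (hS : 0 ≤ S) (hV : 0 ≤ V)
    (hlam0 : lam = 0 → V = 0) :
    -(2 * α / N) * (lam * S) + 2 * α ^ 2 / N ^ 2 * ((lam ^ 2 * S + V) / p)
        + α * (1 / (2 * N * p * lam) * (p * (lam ^ 2 * S) + (1 - p) * V))
      ≤ (1 - α * μ / N) * (α * (1 / (2 * N * p * lam) * V)) := by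
  rcases hlam.eq_or_lt with rfl | hpos
  · simp [hlam0 rfl]
  have h2 : 0 ≤ 3 * (N * p) - 4 * α * lam := by
    have : 0 < α * μ := by positivity
    have : 0 < N * p := by positivity
    linarith
  have h3 : 0 ≤ N * p - α * (4 * lam + μ) := sub_nonneg.2 hstep
  rw [← sub_nonneg]
  have key : (1 - α * μ / N) * (α * (1 / (2 * N * p * lam) * V))
      - (-(2 * α / N) * (lam * S) + 2 * α ^ 2 / N ^ 2 * ((lam ^ 2 * S + V) / p)
        + α * (1 / (2 * N * p * lam) * (p * (lam ^ 2 * S) + (1 - p) * V)))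
      = α * lam * S / (2 * N ^ 2 * p) * (3 * (N * p) - 4 * α * lam)
        + V * (α / (2 * N ^ 2 * p * lam)) * (N * p - α * (4 * lam + μ)) := by
    field_simp
    ring
  rw [key]
  positivity

/-! ### Contraction of the Lyapunov function -/

lemma sum_norm_gradient_sub_sq_le [NeZero m] {L : ℝ≥0} {φ : Fin n → Fin m → Vec d → ℝ}
    (hconvex : ∀ i j, ConvexOn ℝ univ (φ i j)) (hdiff : ∀ i j, Differentiable ℝ (φ i j))
    (hsmooth : ∀ i j, LipschitzWith L (gradient (φ i j))) (x y : Fin n → Vec d) :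
    ∑ i, ∑ j, ‖gradient (φ i j) (x i) - gradient (φ i j) (y i)‖ ^ 2
      ≤ m * L * ∑ i, inner ℝ (localGradient φ i (x i) - localGradient φ i (y i)) (x i - y i) := by
  have hm : (m : ℝ) ≠ 0 := NeZero.ne _
  rw [Finset.mul_sum]
  refine Finset.sum_le_sum fun i _ => ?_
  calc ∑ j, ‖gradient (φ i j) (x i) - gradient (φ i j) (y i)‖ ^ 2
      ≤ ∑ j, L * inner ℝ (gradient (φ i j) (x i) - gradient (φ i j) (y i)) (x i - y i) :=
        Finset.sum_le_sum fun j _ =>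
          norm_gradient_sub_sq_le_inner (hconvex i j) (hdiff i j) (hsmooth i j) _ _
    _ = _ := by
        rw [← Finset.mul_sum, ← sum_inner, localGradient, localGradient, ← smul_sub,
          real_inner_smul_left, Finset.sum_sub_distrib]
        field_simp

/-- A strongly convex function with constant gradient lives on a trivial space. -/
lemma subsingleton_vec_of_smoothness_zero [NeZero n] {μ : ℝ} (hμ : 0 < μ)
    {φ : Fin n → Fin m → Vec d → ℝ} (hdiff : ∀ i j, Differentiable ℝ (φ i j))
    (hsmooth : ∀ i j, LipschitzWith 0 (gradient (φ i j)))
    (hstrong : ∀ i, StrongConvexOn univ μ (localLoss φ i)) : Subsingleton (Vec d) := by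
  refine ⟨fun x y => ?_⟩
  have hgrad : localGradient φ 0 x = localGradient φ 0 y := by
    unfold localGradient
    congr 1
    refine Finset.sum_congr rfl fun j _ => ?_
    have := (hsmooth 0 j).norm_sub_le x y
    simpa [sub_eq_zero] using this
  have h := StrongConvexOn.mul_norm_sub_sq_le_inner (hstrong 0)
    (hasGradientAt_localLoss hdiff 0 y) (hasGradientAt_localLoss hdiff 0 x)
  rw [hgrad, sub_self, inner_zero_left] at h
  have h2 : ‖x - y‖ ^ 2 ≤ 0 := by
    by_contra hneg
    have := mul_pos hμ (not_le.1 hneg)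
    linarith
  have h3 : ‖x - y‖ = 0 := pow_eq_zero_iff two_ne_zero |>.1 (le_antisymm h2 (sq_nonneg _))
  exact sub_eq_zero.1 (norm_eq_zero.1 h3)

/-- The expected squared distance of the models after one iteration. -/
lemma integral_sum_norm_x_step_le [NeZero m] {lam p : ℝ} (hp : p ∈ Ioo (0 : ℝ) 1)
    (α : ℝ) {φ : Fin n → Fin m → Vec d → ℝ} {xs : Fin n → Vec d}
    (hopt : ∀ i, localGradient φ i (xs i) + lam • (xs i - average xs) = 0) (s : State n m d) :
    ∫ w, ∑ i, ‖(step lam p α φ s w).x i - xs i‖ ^ 2 ∂(drawLaw n m p)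
      ≤ ∑ i, ‖s.x i - xs i‖ ^ 2
        - 2 * α / n * ∑ i, inner ℝ
            (localGradient φ i (s.x i) + lam • (s.x i - average s.x)) (s.x i - xs i)
        + 2 * α ^ 2 / n ^ 2 *
          ((∑ i, ∑ j, ‖gradient (φ i j) (s.x i) - gradient (φ i j) (xs i)‖ ^ 2
              + ∑ i, ∑ j, ‖s.J i j - gradient (φ i j) (xs i)‖ ^ 2) / ((1 - p) * m)
            + (∑ i, ‖lam • (s.x i - average s.x) - lam • (xs i - average xs)‖ ^ 2
              + ∑ i, ‖s.Psi i - lam • (xs i - average xs)‖ ^ 2) / p) := by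
  have := isProbabilityMeasure_drawLaw (n := n) (m := m) hp
  have hm : (m : ℝ) ≠ 0 := NeZero.ne _
  rw [integral_finsetSum _ fun i _ => .of_finite]
  have hdev : ∀ i, ∫ w, ‖(step lam p α φ s w).x i - xs i‖ ^ 2 ∂(drawLaw n m p)
      ≤ ‖s.x i - xs i‖ ^ 2
        - 2 * α / n * inner ℝ
            (localGradient φ i (s.x i) + lam • (s.x i - average s.x)) (s.x i - xs i)
        + 2 * α ^ 2 / n ^ 2 *
          ((∑ j, ‖gradient (φ i j) (s.x i) - gradient (φ i j) (xs i)‖ ^ 2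
              + ∑ j, ‖s.J i j - gradient (φ i j) (xs i)‖ ^ 2) / ((1 - p) * m)
            + (‖lam • (s.x i - average s.x) - lam • (xs i - average xs)‖ ^ 2
              + ‖s.Psi i - lam • (xs i - average xs)‖ ^ 2) / p) := by
    intro i
    set g₀ : Fin m → Vec d := fun j => direction lam p φ s (false, fun _ => j) i with hg₀_def
    set g₁ : Vec d := (1 / (n * p)) • (lam • (s.x i - average s.x)) - ((p⁻¹ - 1) / n) • s.Psi i
      + (1 / ((n : ℝ) * m)) • (∑ j, s.J i j) with hg₁
    have hg₀ : ∀ j, g₀ j = (1 / (n * (1 - p))) • (gradient (φ i j) (s.x i) - s.J i j)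
        + (1 / ((n : ℝ) * m)) • (∑ j, s.J i j) + (1 / (n : ℝ)) • s.Psi i := by
      intro j
      simp [hg₀_def, direction]
    have hint := integral_drawLaw (n := n) (m := m) hp i fun b j =>
      ‖(s.x i - xs i) - α • (if b = false then g₀ j else g₁)‖ ^ 2
    have hstep : ∀ w : Draw n m, (step lam p α φ s w).x i - xs i
        = (s.x i - xs i) - α • (if w.1 = false then g₀ (w.2 i) else g₁) := by
      intro w
      have : direction lam p φ s w i = if w.1 = false then g₀ (w.2 i) else g₁ := by
        rw [hg₀, hg₁, smul_smul, one_div_mul_eq_div]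
        rfl
      rw [← this]
      exact sub_right_comm _ _ _
    simp only [Bool.true_eq_false, if_true, if_false, Finset.sum_const, Finset.card_univ,
      Fintype.card_fin, nsmul_eq_mul, inv_mul_cancel_left₀ hm] at hint
    simp_rw [hstep]
    rw [hint, mean_norm_sub_smul_sq, mean_direction hp hg₀ hg₁, real_inner_smul_left]
    have hmom := mean_norm_direction_sq_le (h := fun j => gradient (φ i j) (xs i)) hp (hopt i)
      hg₀ hg₁
    have h2 := mul_le_mul_of_nonneg_left hmom (sq_nonneg α)
    have h3 : inner ℝ ((m : ℝ)⁻¹ • ∑ j, gradient (φ i j) (s.x i) + lam • (s.x i - average s.x))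
        (s.x i - xs i) = inner ℝ
            (localGradient φ i (s.x i) + lam • (s.x i - average s.x)) (s.x i - xs i) := rfl
    rw [h3]
    refine (add_le_add_right h2 _).trans (le_of_eq ?_)
    ring
  refine (Finset.sum_le_sum fun i _ => hdev i).trans (le_of_eq ?_)
  simp only [Finset.sum_add_distrib, Finset.sum_sub_distrib, ← Finset.mul_sum, ← Finset.sum_div]

/-- Each column of a gradient table is refreshed with probability `(1 - p) / m`. -/
lemma integral_sum_norm_J_step [NeZero m] {lam p : ℝ} (hp : p ∈ Ioo (0 : ℝ) 1) (α : ℝ)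
    {φ : Fin n → Fin m → Vec d → ℝ} (xs : Fin n → Vec d) (s : State n m d) :
    ∫ w, ∑ i, ∑ j, ‖(step lam p α φ s w).J i j - gradient (φ i j) (xs i)‖ ^ 2 ∂(drawLaw n m p)
      = ∑ i, ∑ j, ‖s.J i j - gradient (φ i j) (xs i)‖ ^ 2
        - (1 - p) / m * (∑ i, ∑ j, ‖s.J i j - gradient (φ i j) (xs i)‖ ^ 2
          - ∑ i, ∑ j, ‖gradient (φ i j) (s.x i) - gradient (φ i j) (xs i)‖ ^ 2) := by
  have := isProbabilityMeasure_drawLaw (n := n) (m := m) hp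
  have hm : (m : ℝ) ≠ 0 := NeZero.ne _
  rw [integral_finsetSum _ fun i _ => .of_finite]
  have hdev : ∀ i, ∫ w, ∑ j, ‖(step lam p α φ s w).J i j - gradient (φ i j) (xs i)‖ ^ 2
        ∂(drawLaw n m p)
      = ∑ j, ‖s.J i j - gradient (φ i j) (xs i)‖ ^ 2
        - (1 - p) / m * (∑ j, ‖s.J i j - gradient (φ i j) (xs i)‖ ^ 2
          - ∑ j, ‖gradient (φ i j) (s.x i) - gradient (φ i j) (xs i)‖ ^ 2) := by
    intro i
    set u : Fin m → ℝ := fun j => ‖s.J i j - gradient (φ i j) (xs i)‖ ^ 2 with hu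
    set v : Fin m → ℝ := fun j => ‖gradient (φ i j) (s.x i) - gradient (φ i j) (xs i)‖ ^ 2 with hv
    have hint := integral_drawLaw (n := n) (m := m) hp i fun b l =>
      ∑ j, (u j + if b = false ∧ j = l then v j - u j else 0)
    have hstep : ∀ w : Draw n m,
        ∑ j, ‖(step lam p α φ s w).J i j - gradient (φ i j) (xs i)‖ ^ 2
        = ∑ j, (u j + if w.1 = false ∧ j = w.2 i then v j - u j else 0) := by
      intro w
      refine Finset.sum_congr rfl fun j _ => ?_
      simp only [step, hu, hv]
      split_ifs <;> simp
    simp_rw [hstep]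
    rw [hint]
    simp [Finset.sum_add_distrib]
    field_simp
    ring
  simp_rw [hdev]
  simp only [Finset.sum_sub_distrib, ← Finset.mul_sum]

/-- The control variates of the penalty are refreshed with probability `p`. -/
lemma integral_sum_norm_Psi_step [NeZero m] {lam p : ℝ} (hp : p ∈ Ioo (0 : ℝ) 1) (α : ℝ)
    {φ : Fin n → Fin m → Vec d → ℝ} (ψ : Fin n → Vec d) (s : State n m d) :
    ∫ w, ∑ i, ‖(step lam p α φ s w).Psi i - ψ i‖ ^ 2 ∂(drawLaw n m p)
      = p * ∑ i, ‖lam • (s.x i - average s.x) - ψ i‖ ^ 2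
        + (1 - p) * ∑ i, ‖s.Psi i - ψ i‖ ^ 2 := by
  have := isProbabilityMeasure_drawLaw (n := n) (m := m) hp
  have hm : (m : ℝ) ≠ 0 := NeZero.ne _
  rw [integral_finsetSum _ fun i _ => .of_finite, Finset.mul_sum, Finset.mul_sum,
    ← Finset.sum_add_distrib]
  refine Finset.sum_congr rfl fun i _ => ?_
  have hint := integral_drawLaw (n := n) (m := m) hp i fun b _ =>
    ‖(if b = false then s.Psi i else lam • (s.x i - average s.x)) - ψ i‖ ^ 2
  simp only [step]
  rw [hint]
  simp [hm]

/-- One iteration contracts the expected Lyapunov function by the factor `1 - αμ/n`. Strong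
convexity uses up half of the term `⟪∇F(x) - ∇F(x⋆), x - x⋆⟫`; the other half balances the noise. -/
theorem integral_lyapunov_step_le [NeZero n] [NeZero m] {lam μ p α : ℝ} {L : ℝ≥0} (hlam : 0 ≤ lam)
    (hμ : 0 < μ) {φ : Fin n → Fin m → Vec d → ℝ}
    (hconvex : ∀ i j, ConvexOn ℝ univ (φ i j)) (hdiff : ∀ i j, Differentiable ℝ (φ i j))
    (hsmooth : ∀ i j, LipschitzWith L (gradient (φ i j)))
    (hstrong : ∀ i, StrongConvexOn univ μ (localLoss φ i)) (hp : p ∈ Ioo (0 : ℝ) 1)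
    (hα : 0 < α) (hαL : α * (4 * L + μ * m) ≤ n * (1 - p)) (hαlam : α * (4 * lam + μ) ≤ n * p)
    {xs : Fin n → Vec d} (hopt : ∀ i, localGradient φ i (xs i) + lam • (xs i - average xs) = 0)
    {s : State n m d} (hs : lam = 0 → s.Psi = 0) :
    ∫ w, lyapunov lam L p α φ xs (step lam p α φ s w) ∂(drawLaw n m p)
      ≤ (1 - α * μ / n) * lyapunov lam L p α φ xs s := by
  have := isProbabilityMeasure_drawLaw (n := n) (m := m) hp
  have hn : (0 : ℝ) < n := Nat.cast_pos.2 (NeZero.pos n)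
  have hm : (0 : ℝ) < m := Nat.cast_pos.2 (NeZero.pos m)
  have hp0 : 0 < p := hp.1
  have hq0 : 0 < 1 - p := sub_pos.2 hp.2
  have hx := integral_sum_norm_x_step_le hp α hopt s
  have hJ := integral_sum_norm_J_step (lam := lam) (φ := φ) hp α xs s
  have hPsi := integral_sum_norm_Psi_step (lam := lam) (φ := φ) hp α
    (fun i => lam • (xs i - average xs)) s
  have hmono := mul_sum_norm_sub_sq_le hdiff hstrong s.x xs
  have hcoco := sum_norm_gradient_sub_sq_le hconvex hdiff hsmooth s.x xs
  have hS := sum_inner_sub_average fun i => s.x i - xs i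
  have hB : ∑ i, ‖lam • (s.x i - average s.x) - lam • (xs i - average xs)‖ ^ 2
      = lam ^ 2 * ∑ i, ‖s.x i - xs i - average fun i => s.x i - xs i‖ ^ 2 := by
    rw [Finset.mul_sum]
    refine Finset.sum_congr rfl fun i _ => ?_
    rw [← smul_sub, norm_smul, mul_pow, Real.norm_eq_abs, sq_abs, average_sub]
    congr 3
    abel
  have hinner : ∑ i, inner ℝ (localGradient φ i (s.x i) + lam • (s.x i - average s.x))
        (s.x i - xs i)
      = ∑ i, inner ℝ (localGradient φ i (s.x i) - localGradient φ i (xs i)) (s.x i - xs i)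
        + lam * ∑ i, ‖s.x i - xs i - average fun i => s.x i - xs i‖ ^ 2 := by
    rw [← hS, Finset.mul_sum, ← Finset.sum_add_distrib]
    refine Finset.sum_congr rfl fun i _ => ?_
    rw [← real_inner_smul_left, ← inner_add_left, eq_neg_of_add_eq_zero_left (hopt i), average_sub]
    congr 1
    module
  rw [hB] at hx hPsi
  rw [hinner] at hx
  -- For `L = 0` or `λ = 0` the Lyapunov function does not see the error of the corresponding control
  -- variates (`1 / 0 = 0`), so that error has to vanish.
  have hU0 : (L : ℝ) = 0 → ∑ i, ∑ j, ‖s.J i j - gradient (φ i j) (xs i)‖ ^ 2 = 0 := by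
    intro h0
    have hL0 : L = 0 := by exact_mod_cast h0
    have := subsingleton_vec_of_smoothness_zero hμ hdiff (hL0 ▸ hsmooth) hstrong
    refine Finset.sum_eq_zero fun i _ => Finset.sum_eq_zero fun j _ => ?_
    rw [Subsingleton.elim (s.J i j - gradient (φ i j) (xs i)) 0]
    simp
  have hV0 : lam = 0 → ∑ i, ‖s.Psi i - lam • (xs i - average xs)‖ ^ 2 = 0 := by
    intro h0
    simp [hs h0, h0]
  have hA0 : 0 ≤ ∑ i, ∑ j, ‖gradient (φ i j) (s.x i) - gradient (φ i j) (xs i)‖ ^ 2 := by positivity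
  have hUn : 0 ≤ ∑ i, ∑ j, ‖s.J i j - gradient (φ i j) (xs i)‖ ^ 2 := by positivity
  have hVn : 0 ≤ ∑ i, ‖s.Psi i - lam • (xs i - average xs)‖ ^ 2 := by positivity
  have hSn : 0 ≤ ∑ i, ‖s.x i - xs i - average fun i => s.x i - xs i‖ ^ 2 := by positivity
  have hYn : 0 ≤ ∑ i, ‖s.x i - xs i‖ ^ 2 := by positivity
  have hDn := (mul_nonneg hμ.le hYn).trans hmono
  simp only [lyapunov]
  rw [integral_add .of_finite .of_finite, integral_const_mul, integral_add .of_finite .of_finite,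
    integral_const_mul, integral_const_mul, hJ, hPsi]
  have h1 := table_balance hn hm hq0 hα hμ L.coe_nonneg hαL hA0 hUn hDn hcoco hU0
  have h2 := control_balance hn hp0 hα hμ hlam hαlam hSn hVn hV0
  have h3 := mul_le_mul_of_nonneg_left hmono (div_pos hα hn).le
  generalize (∑ i, ‖s.x i - xs i‖ ^ 2) = Y at *
  generalize (∑ i, ‖s.x i - xs i - average fun i => s.x i - xs i‖ ^ 2) = S at *
  generalize (∑ i, ‖s.Psi i - lam • (xs i - average xs)‖ ^ 2) = V at *
  generalize (∑ i, ∑ j, ‖s.J i j - gradient (φ i j) (xs i)‖ ^ 2) = U at *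
  generalize (∑ i, ∑ j, ‖gradient (φ i j) (s.x i) - gradient (φ i j) (xs i)‖ ^ 2) = A at *
  generalize (∑ i, inner ℝ (localGradient φ i (s.x i) - localGradient φ i (xs i)) (s.x i - xs i))
    = D at *
  refine (add_le_add_left hx _).trans ?_
  -- Half of the term `2α/n * D` goes to the distance, the other half to the gradient tables.
  calc _ = (Y - α / n * D) + (-(α / n) * D + 2 * α ^ 2 / n ^ 2 * ((A + U) / ((1 - p) * m))
        + α * (1 / (2 * n * (1 - p) * L) * (U - (1 - p) / m * (U - A))))
        + (-(2 * α / n) * (lam * S) + 2 * α ^ 2 / n ^ 2 * ((lam ^ 2 * S + V) / p)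
        + α * (1 / (2 * n * p * lam) * (p * (lam ^ 2 * S) + (1 - p) * V))) := by ring
    _ ≤ (Y - α / n * (μ * Y)) + (1 - α * μ / n) * (α * (1 / (2 * n * (1 - p) * L) * U))
        + (1 - α * μ / n) * (α * (1 / (2 * n * p * lam) * V)) := by
        gcongr
    _ = _ := by ring

/-- The state after `k` iterations is determined by the draws `0, …, k - 1`. -/
lemma dependsOn_iterate (lam p α : ℝ) (φ : Fin n → Fin m → Vec d → ℝ) (x0 : Vec d) (k : ℕ) :
    DependsOn (fun ω => iterate lam p α φ x0 ω k) (Iio k) := by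
  induction k with
  | zero => exact fun _ _ _ => rfl
  | succ k ih =>
    intro ω ω' h
    simp only [iterate]
    rw [h k (mem_Iio.2 k.lt_succ_self)]
    have : iterate lam p α φ x0 ω k = iterate lam p α φ x0 ω' k :=
      ih fun i hi => h i (mem_Iio.2 ((mem_Iio.1 hi).trans k.lt_succ_self))
    rw [this]

lemma iterate_Psi_eq_zero (p α : ℝ) (φ : Fin n → Fin m → Vec d → ℝ) (x0 : Vec d)
    (ω : ℕ → Draw n m) (k : ℕ) : (iterate 0 p α φ x0 ω k).Psi = 0 := by
  induction k with
  | zero => rfl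
  | succ k ih =>
    funext i
    simp [iterate, step, ih]

lemma integrable_lyapunov_iterate [NeZero m] {p : ℝ} (hp : p ∈ Ioo (0 : ℝ) 1) (lam L α : ℝ)
    (φ : Fin n → Fin m → Vec d → ℝ) (xs : Fin n → Vec d) (x0 : Vec d) (k : ℕ) :
    Integrable (fun ω => lyapunov lam L p α φ xs (iterate lam p α φ x0 ω k)) (runLaw n m p) := by
  have := isProbabilityMeasure_drawLaw (n := n) (m := m) hp
  exact integrable_infinitePi_of_dependsOn (k := k) fun ω ω' h =>
    congrArg (lyapunov lam L p α φ xs) (dependsOn_iterate lam p α φ x0 k h)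

theorem integral_lyapunov_iterate_le [NeZero n] [NeZero m] {lam μ p α : ℝ} {L : ℝ≥0}
    (hlam : 0 ≤ lam) (hμ : 0 < μ) {φ : Fin n → Fin m → Vec d → ℝ}
    (hconvex : ∀ i j, ConvexOn ℝ univ (φ i j)) (hdiff : ∀ i j, Differentiable ℝ (φ i j))
    (hsmooth : ∀ i j, LipschitzWith L (gradient (φ i j)))
    (hstrong : ∀ i, StrongConvexOn univ μ (localLoss φ i)) (hp : p ∈ Ioo (0 : ℝ) 1)
    (hα : 0 < α) (hαL : α * (4 * L + μ * m) ≤ n * (1 - p)) (hαlam : α * (4 * lam + μ) ≤ n * p)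
    (hρ : 0 ≤ 1 - α * μ / n)
    {xs : Fin n → Vec d} (hopt : ∀ i, localGradient φ i (xs i) + lam • (xs i - average xs) = 0)
    (x0 : Vec d) (k : ℕ) :
    ∫ ω, lyapunov lam L p α φ xs (iterate lam p α φ x0 ω k) ∂(runLaw n m p)
      ≤ (1 - α * μ / n) ^ k * lyapunov lam L p α φ xs ⟨fun _ => x0, fun _ _ => 0, fun _ => 0⟩ := by
  have := isProbabilityMeasure_drawLaw (n := n) (m := m) hp
  induction k with
  | zero =>
    have : IsProbabilityMeasure (runLaw n m p) := by unfold runLaw; infer_instance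
    simp [iterate]
  | succ k ih =>
    have hdep : ∀ w : Draw n m, DependsOn
        (fun ω => lyapunov lam L p α φ xs (step lam p α φ (iterate lam p α φ x0 ω k) w))
        (Iio k) := fun w ω ω' h =>
      congrArg (fun s => lyapunov lam L p α φ xs (step lam p α φ s w))
        (dependsOn_iterate lam p α φ x0 k h)
    calc ∫ ω, lyapunov lam L p α φ xs (iterate lam p α φ x0 ω (k + 1)) ∂(runLaw n m p)
        = ∫ ω, ∫ w, lyapunov lam L p α φ xs (step lam p α φ (iterate lam p α φ x0 ω k) w)
            ∂(drawLaw n m p) ∂(runLaw n m p) := integral_infinitePi_of_dependsOn hdep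
      _ ≤ ∫ ω, (1 - α * μ / n) * lyapunov lam L p α φ xs (iterate lam p α φ x0 ω k)
            ∂(runLaw n m p) := by
          refine integral_mono (integrable_infinitePi_of_dependsOn (k := k) ?_)
            ((integrable_lyapunov_iterate hp lam L α φ xs x0 k).const_mul _) fun ω => ?_
          · intro ω ω' h
            simp only [fun w => hdep w h]
          · refine integral_lyapunov_step_le hlam hμ hconvex hdiff hsmooth hstrong hp hα hαL hαlam
              hopt ?_
            rintro rfl
            exact iterate_Psi_eq_zero p α φ x0 ω k
      _ ≤ _ := by
          rw [integral_const_mul, pow_succ', mul_assoc]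
          exact mul_le_mul_of_nonneg_left ih hρ

/-! ### Complexities as functions of the probability -/

section Complexity

variable {lam μ L p ε : ℝ}

lemma stepsize_pos [NeZero n] [NeZero m] (hlam : 0 ≤ lam) (hμ : 0 < μ) (hL : 0 ≤ L)
    (hp : p ∈ Ioo (0 : ℝ) 1) : 0 < stepsize n m lam μ L p := by
  have hn : (0 : ℝ) < n := Nat.cast_pos.2 (NeZero.pos n)
  have hm : (0 : ℝ) < m := Nat.cast_pos.2 (NeZero.pos m)
  have hp0 : 0 < p := hp.1
  have hq0 : 0 < 1 - p := sub_pos.2 hp.2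
  unfold stepsize
  positivity

lemma stepsize_mul_le_left [NeZero m] (hμ : 0 < μ) (hL : 0 ≤ L) :
    stepsize n m lam μ L p * (4 * L + μ * m) ≤ n * (1 - p) := by
  have hm : (0 : ℝ) < m := Nat.cast_pos.2 (NeZero.pos m)
  unfold stepsize
  rw [mul_assoc]
  gcongr
  exact (le_div_iff₀ (by positivity)).1 (min_le_left _ _)

lemma stepsize_mul_le_right (hlam : 0 ≤ lam) (hμ : 0 < μ) :
    stepsize n m lam μ L p * (4 * lam + μ) ≤ n * p := by
  unfold stepsize
  rw [mul_assoc]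
  gcongr
  exact (le_div_iff₀ (by positivity)).1 (min_le_right _ _)

/-- The iteration complexity is `log (1/ε)` divided by the contraction gap `αμ/n`. -/
lemma iterationComplexity_mul_stepsize [NeZero n] [NeZero m] (hlam : 0 ≤ lam) (hμ : 0 < μ)
    (hL : 0 ≤ L) (hp : p ∈ Ioo (0 : ℝ) 1) :
    iterationComplexity m lam μ L ε p * (stepsize n m lam μ L p * μ / n) = Real.log (1 / ε) := by
  have hn : (0 : ℝ) < n := Nat.cast_pos.2 (NeZero.pos n)
  have hm : (0 : ℝ) < m := Nat.cast_pos.2 (NeZero.pos m)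
  have hp0 : 0 < p := hp.1
  have hq0 : 0 < 1 - p := sub_pos.2 hp.2
  have hA : 0 < 4 * L + μ * m := by positivity
  have hB : 0 < 4 * lam + μ := by positivity
  unfold iterationComplexity stepsize
  rcases le_total ((1 - p) / (4 * L + μ * m)) (p / (4 * lam + μ)) with h | h
  · have h' : (4 * lam + μ) / (p * μ) ≤ (4 * L + μ * m) / ((1 - p) * μ) := by
      rw [div_le_div_iff₀ hA hB] at h
      rw [div_le_div_iff₀ (by positivity) (by positivity)]
      nlinarith
    rw [min_eq_left h, max_eq_left h']
    field_simp
  · have h' : (4 * L + μ * m) / ((1 - p) * μ) ≤ (4 * lam + μ) / (p * μ) := by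
      rw [div_le_div_iff₀ hB hA] at h
      rw [div_le_div_iff₀ (by positivity) (by positivity)]
      nlinarith
    rw [min_eq_right h, max_eq_right h']
    field_simp

theorem reachesAccuracyAfter_iterationComplexity [NeZero n] [NeZero m] {L : ℝ≥0}
    (hlam : 0 ≤ lam) (hμ : 0 < μ) {φ : Fin n → Fin m → Vec d → ℝ}
    (hconvex : ∀ i j, ConvexOn ℝ univ (φ i j)) (hdiff : ∀ i j, Differentiable ℝ (φ i j))
    (hsmooth : ∀ i j, LipschitzWith L (gradient (φ i j)))
    (hstrong : ∀ i, StrongConvexOn univ μ (localLoss φ i)) (hp : p ∈ Ioo (0 : ℝ) 1)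
    {xs : Fin n → Vec d} (hopt : ∀ i, localGradient φ i (xs i) + lam • (xs i - average xs) = 0)
    (x0 : Vec d) (hε : ε ∈ Ioo (0 : ℝ) 1) :
    ReachesAccuracyAfter lam L p (stepsize n m lam μ L p) φ xs x0 ε
      (iterationComplexity m lam μ L ε p) := by
  have hn : (0 : ℝ) < n := Nat.cast_pos.2 (NeZero.pos n)
  have hp0 : 0 < p := hp.1
  have hq0 : 0 < 1 - p := sub_pos.2 hp.2
  have hα : 0 < stepsize n m lam μ L p := stepsize_pos hlam hμ L.coe_nonneg hp
  have hαlam : stepsize n m lam μ L p * (4 * lam + μ) ≤ n * p := stepsize_mul_le_right hlam hμ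
  have hT := iterationComplexity_mul_stepsize (n := n) (m := m) (ε := ε) hlam hμ L.coe_nonneg hp
  set α := stepsize n m lam μ L p
  have hρ : 0 ≤ 1 - α * μ / n := by
    rw [sub_nonneg, div_le_one hn]
    have : 0 ≤ α * (4 * lam) := by positivity
    have : n * p ≤ n * 1 := by gcongr; exact hp.2.le
    linarith
  intro k hk
  refine ⟨integrable_lyapunov_iterate hp lam L α φ xs x0 k,
    (integral_lyapunov_iterate_le hlam hμ hconvex hdiff hsmooth hstrong hp hα
      (stepsize_mul_le_left hμ L.coe_nonneg) hαlam hρ hopt x0 k).trans ?_⟩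
  have hnonneg : 0 ≤ lyapunov lam L p α φ xs ⟨fun _ => x0, fun _ _ => 0, fun _ => 0⟩ := by
    unfold lyapunov
    positivity
  refine mul_le_mul_of_nonneg_right ?_ hnonneg
  have hlog : Real.log (1 / ε) ≤ k * (α * μ / n) := by
    rw [← hT]
    gcongr
  calc (1 - α * μ / n) ^ k ≤ Real.exp (-(α * μ / n)) ^ k := by
        gcongr
        exact Real.one_sub_le_exp_neg _
    _ = Real.exp (-(k * (α * μ / n))) := by rw [← Real.exp_nat_mul]; ring_nf
    _ ≤ Real.exp (Real.log ε) := by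
        rw [one_div, Real.log_inv] at hlog
        gcongr
        linarith
    _ = ε := Real.exp_log hε.1

/-- The two terms of the maximum in the iteration complexity balance at `b / (a + b)`, where the
first increases and the second decreases in `p`. -/
lemma max_div_lt_max_div {a b μ : ℝ} (ha : 0 < a) (hb : 0 < b) (hμ : 0 < μ)
    (hp : p ∈ Ioo (0 : ℝ) 1) (hne : p ≠ b / (a + b)) :
    (a + b) / μ < max (a / ((1 - p) * μ)) (b / (p * μ)) := by
  have hp0 : 0 < p := hp.1
  have hq0 : 0 < 1 - p := sub_pos.2 hp.2
  have hab : 0 < a + b := by positivity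
  rw [lt_max_iff]
  rcases hne.lt_or_gt with h | h
  · right
    rw [lt_div_iff₀ hab] at h
    rw [div_lt_div_iff₀ hμ (by positivity)]
    nlinarith
  · left
    rw [div_lt_iff₀ hab] at h
    rw [div_lt_div_iff₀ hμ (by positivity)]
    nlinarith

/-- Multiplied by `p (1 - p)`, the two terms of the maximum still balance at `b / (a + b)`. -/
lemma mul_div_lt_mul_max_div {a b μ : ℝ} (ha : 0 < a) (hb : 0 < b) (hμ : 0 < μ)
    (hp : p ∈ Ioo (0 : ℝ) 1) (hne : p ≠ b / (a + b)) :
    b / (a + b) * (a / μ) < p * (1 - p) * max (a / ((1 - p) * μ)) (b / (p * μ)) := by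
  have hp0 : 0 < p := hp.1
  have hq0 : 0 < 1 - p := sub_pos.2 hp.2
  have hab : 0 < a + b := by positivity
  have h1 : p * (1 - p) * (a / ((1 - p) * μ)) = p * (a / μ) := by field_simp
  have h2 : p * (1 - p) * (b / (p * μ)) = (1 - p) * (b / μ) := by field_simp
  rw [mul_max_of_nonneg _ _ (by positivity), h1, h2, lt_max_iff]
  rcases hne.lt_or_gt with h | h
  · right
    have h3 : b / (a + b) * (a / μ) = (1 - b / (a + b)) * (b / μ) := by
      field_simp
      ring
    rw [h3]
    gcongr
  · left
    gcongr

lemma max_div_balanced {a b μ : ℝ} (ha : 0 < a) (hb : 0 < b) (hμ : 0 < μ) :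
    max (a / ((1 - b / (a + b)) * μ)) (b / (b / (a + b) * μ)) = (a + b) / μ := by
  have hab : 0 < a + b := by positivity
  have h1 : 1 - b / (a + b) = a / (a + b) := by
    field_simp
    ring
  have h2 : a / (a / (a + b) * μ) = (a + b) / μ := by field_simp
  have h3 : b / (b / (a + b) * μ) = (a + b) / μ := by field_simp
  rw [h1, h2, h3, max_self]

end Complexity

end L2SGDPlus

theorem mainTheorem7 (n m d : ℕ) [NeZero n] [NeZero m] (lam μ : ℝ) (L : ℝ≥0)
    (hlam : 0 ≤ lam) (hμ : 0 < μ)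
    (φ : Fin n → Fin m → L2SGDPlus.Vec d → ℝ)
    (hconvex : ∀ i j, ConvexOn ℝ univ (φ i j))
    (hdiff : ∀ i j, Differentiable ℝ (φ i j))
    (hsmooth : ∀ i j, LipschitzWith L (gradient (φ i j)))
    (hstrong : ∀ i, StrongConvexOn univ μ (L2SGDPlus.localLoss φ i)) :
    -- the objective has a unique minimizer, and `iterationComplexity` iterations suffice
    (∃ xs : Fin n → L2SGDPlus.Vec d,
      (∀ y, IsMinOn (L2SGDPlus.objective lam φ) univ y ↔ y = xs) ∧
      ∀ p ∈ Ioo (0 : ℝ) 1, ∀ x0 : L2SGDPlus.Vec d, ∀ ε ∈ Ioo (0 : ℝ) 1,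
        L2SGDPlus.ReachesAccuracyAfter lam L p (L2SGDPlus.stepsize n m lam μ L p) φ xs x0 ε
          (L2SGDPlus.iterationComplexity m lam μ L ε p)) ∧
    -- the expected number of communication rounds in `k` iterations is `p (1 - p) k`
    (∀ p ∈ Ioo (0 : ℝ) 1, ∀ k : ℕ,
      L2SGDPlus.expectedCommRounds n m p k = p * (1 - p) * k) ∧
    -- the optimal probability and the resulting complexities
    ∃ ps ∈ Ioo (0 : ℝ) 1,
      ps = (4 * lam + μ) / (4 * lam + 4 * L + (m + 1) * μ) ∧
      ∀ ε ∈ Ioo (0 : ℝ) 1,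
        (∀ p ∈ Ioo (0 : ℝ) 1, p ≠ ps →
          L2SGDPlus.iterationComplexity m lam μ L ε ps
            < L2SGDPlus.iterationComplexity m lam μ L ε p) ∧
        (∀ p ∈ Ioo (0 : ℝ) 1, p ≠ ps →
          L2SGDPlus.communicationComplexity n m lam μ L ε ps
            < L2SGDPlus.communicationComplexity n m lam μ L ε p) ∧
        L2SGDPlus.iterationComplexity m lam μ L ε ps
          = (4 * (lam / μ) + 4 * (L / μ) + m + 1) * Real.log (1 / ε) ∧
        L2SGDPlus.communicationComplexity n m lam μ L ε ps
          = (4 * lam + μ) / (4 * L + 4 * lam + (m + 1) * μ) * (4 * (L / μ) + m)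
              * Real.log (1 / ε) := by
  have hm : (0 : ℝ) < m := Nat.cast_pos.2 (NeZero.pos m)
  have hL : (0 : ℝ) ≤ L := L.coe_nonneg
  refine ⟨?_, fun p hp k => L2SGDPlus.expectedCommRounds_eq hp k, ?_⟩
  · obtain ⟨xs, hxs⟩ := L2SGDPlus.exists_isMinOn_objective hlam hμ hdiff hstrong
    refine ⟨xs, fun y => ⟨fun hy => L2SGDPlus.isMinOn_objective_unique hlam hμ hdiff hstrong hy hxs,
      fun hy => hy ▸ hxs⟩, fun p hp x0 ε hε => ?_⟩
    exact L2SGDPlus.reachesAccuracyAfter_iterationComplexity hlam hμ hconvex hdiff hsmooth hstrong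
      hp (L2SGDPlus.localGradient_add_eq_zero hdiff hxs) x0 hε
  set a : ℝ := 4 * L + μ * m with ha_def
  set b : ℝ := 4 * lam + μ with hb_def
  have ha : 0 < a := by positivity
  have hb : 0 < b := by positivity
  have hab : 0 < a + b := by positivity
  have hps : b / (4 * lam + 4 * L + (m + 1) * μ) = b / (a + b) := by
    congr 1
    simp only [ha_def, hb_def]
    ring
  have hmem : b / (a + b) ∈ Ioo (0 : ℝ) 1 :=
    ⟨by positivity, (div_lt_one hab).2 (lt_add_of_pos_left b ha)⟩
  refine ⟨b / (a + b), hmem, hps.symm, fun ε hε => ?_⟩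
  have hlog : 0 < Real.log (1 / ε) := Real.log_pos ((one_lt_div hε.1).2 hε.2)
  have hT : L2SGDPlus.iterationComplexity m lam μ L ε (b / (a + b))
      = (a + b) / μ * Real.log (1 / ε) := by
    rw [L2SGDPlus.iterationComplexity, ← ha_def, ← hb_def, L2SGDPlus.max_div_balanced ha hb hμ]
  have hC : L2SGDPlus.communicationComplexity n m lam μ L ε (b / (a + b))
      = b / (a + b) * (a / μ) * Real.log (1 / ε) := by
    rw [L2SGDPlus.communicationComplexity, L2SGDPlus.expectedCommRounds_eq hmem, hT]
    field_simp
    push_cast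
    ring
  refine ⟨fun p hp hne => ?_, fun p hp hne => ?_, ?_, ?_⟩
  · rw [hT, L2SGDPlus.iterationComplexity]
    gcongr
    exact L2SGDPlus.max_div_lt_max_div ha hb hμ hp hne
  · rw [hC, L2SGDPlus.communicationComplexity, L2SGDPlus.expectedCommRounds_eq hp,
      L2SGDPlus.iterationComplexity, Nat.cast_one, mul_one, ← mul_assoc]
    exact mul_lt_mul_of_pos_right (L2SGDPlus.mul_div_lt_mul_max_div ha hb hμ hp hne) hlog
  · rw [hT, ha_def, hb_def]
    field_simp
    ring
  · rw [hC, add_comm (4 * (L : ℝ)), hps]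
    congr 2
    rw [ha_def]
    field_simp
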